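/- Let $A$ be a C*-algebra with multiplier algebra $M(A)$ (so $M(A)=A$ if $A$ is unital), let $T$ be a locally compact Hausdorff space with a Radon measure $\mu$, let $I\subseteq\mathbb R$ be an interval and let $f\colon I\to\mathbb R$ be continuous and convex. Let $(x_t)_{t\in T}$ be a bounded, norm continuous family of self-adjoint elements of $A$ with $\operatorname{sp}(x_t)\subseteq I$ for all $t$ (spectra taken in $M(A)$), and let $(a_t)_{t\in T}$ be a unital column field in $M(A)$, i.e. a norm continuous family such that $(a_t^*a_t)$ is Bochner integrable with $\int_T a_t^*a_t\,d\mu(t)=1$. Then $(a_t^*x_ta_t)$ is Bochner integrable in $A$, and $y=\int_T a_t^*x_ta_t\,d\mu(t)\in A$ is self-adjoint with $\operatorname{sp}(y)\subseteq I$. The family $(a_t^*f(x_t)a_t)$ is Bochner integrable in $M(A)$ if $I$ is closed or if $(f(x_t))$ is bounded. Whenever it is Bochner integrable, the following hold. (i) For every positive linear functional $\varphi$ on $A$ whose centralizer contains $y$, i.e. $\varphi(xy)=\varphi(yx)$ for all $x\in A$, $$\varphi\Big(f\Big(\int_T a_t^*x_ta_t\,d\mu(t)\Big)\Big)\le\varphi\Big(\int_T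 a_t^*f(x_t)a_t\,d\mu(t)\Big).$$ (ii) Suppose that $f\ge0$ on $I$. Let $\varphi\colon A_+\to[0,\infty]$ be additive, positively homogeneous, lower semicontinuous, and finite on the positive part of the minimal dense ideal $K(A)$ (the linear span of the positive elements of $A$ that are dominated by a finite sum of elements $z\in A_+$ with $z=ze$ for some $e\in A_+$), and suppose that the centralizer of $\varphi$ contains $y$, i.e. $\varphi(xy)=\varphi(yx)$ for all $x\in K(A)$, where $\varphi$ is extended linearly to $K(A)$. Then the same inequality holds in $[0,\infty]$. If $f(y)$ or $\int_T a_t^*f(x_t)a_t\,d\mu(t)$ is not in $A$, then $\varphi$ stands for its canonical extension to $M(A)$: in (i), $\varphi(m)=\lim_\lambda\varphi(me_\lambda)$ for an increasing approximate unit $(e_\lambda)$ of $A$ consisting of positive contractions; in (ii), $\varphi(m)=\sup\{\varphi(x): x\in A_+,\ x\le m\}$ for $m\in M(A)_+$. -/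

import Mathlib

open MeasureTheory Filter Topology
open scoped MultiplierAlgebra ComplexOrder NNReal ENNReal ComplexStarModule

namespace CStarJensen

section

variable {A : Type*} [NonUnitalCStarAlgebra A]

/-- The usual order of the C*-algebra `M(A)`: `m ≤ n` iff `n - m` is self-adjoint with
nonnegative spectrum. -/
noncomputable instance : PartialOrder 𝓜(ℂ, A) := CStarAlgebra.spectralOrder _

instance : StarOrderedRing 𝓜(ℂ, A) := CStarAlgebra.spectralOrderedRing _

/-- For `a ∈ M(A)` and `x ∈ A`, the element `a* x a` of `A`. Here `a.snd x` is `x a`, and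
`(star a).fst z` is `a* z`. -/
noncomputable def sandwich (a : 𝓜(ℂ, A)) (x : A) : A := (star a).fst (a.snd x)

theorem fst_mul (m : 𝓜(ℂ, A)) (u v : A) : m.fst u * v = m.fst (u * v) := by
  have key : ∀ w : A, w * (m.fst u * v - m.fst (u * v)) = 0 := by
    intro w
    rw [mul_sub, ← mul_assoc, ← m.central, ← m.central, mul_assoc, sub_self]
  have := key (star (m.fst u * v - m.fst (u * v)))
  exact sub_eq_zero.mp (CStarRing.star_mul_self_eq_zero_iff _ |>.mp this)

theorem coe_sandwich (a : 𝓜(ℂ, A)) (x : A) :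
    ((sandwich a x : A) : 𝓜(ℂ, A)) = star a * (x : 𝓜(ℂ, A)) * a := by
  have h1 := fst_mul (A := A)
  have h2 : ∀ (m : 𝓜(ℂ, A)) (u v : A), u * m.snd v = m.snd (u * v) := by
    intro m u v
    have key : ∀ w : A, (u * m.snd v - m.snd (u * v)) * w = 0 := by
      intro w
      rw [sub_mul, mul_assoc, m.central, m.central, mul_assoc, sub_self]
    have := key (star (u * m.snd v - m.snd (u * v)))
    exact sub_eq_zero.mp (CStarRing.mul_star_self_eq_zero_iff _ |>.mp this)
  have h3 : ∀ (m n : 𝓜(ℂ, A)) (u : A), m.fst (n.snd u) = n.snd (m.fst u) := by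
    intro m n u
    have key : ∀ w : A, w * (m.fst (n.snd u) - n.snd (m.fst u)) = 0 := by
      intro w
      rw [mul_sub, ← m.central, h2, h2, ← m.central, sub_self]
    have := key (star (m.fst (n.snd u) - n.snd (m.fst u)))
    exact sub_eq_zero.mp (CStarRing.star_mul_self_eq_zero_iff _ |>.mp this)
  refine DoubleCentralizer.ext ℂ A _ _ (Prod.ext ?_ ?_)
  · refine ContinuousLinearMap.ext fun z => ?_
    simp only [sandwich, DoubleCentralizer.coe_fst, DoubleCentralizer.mul_fst,
      ContinuousLinearMap.mul_apply', mul_apply_eq_comp]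
    rw [h1, a.central]
  · refine ContinuousLinearMap.ext fun z => ?_
    simp only [sandwich, DoubleCentralizer.coe_snd, DoubleCentralizer.mul_snd,
      ContinuousLinearMap.mul_apply', ContinuousLinearMap.flip_apply,
      mul_apply_eq_comp]
    rw [h3, h2, ← (star a).central]

/-- A unital column field in `M(A)`: a norm continuous family `(a_t)` such that `(a_t* a_t)` is
integrable with integral `1`. -/
structure IsUnitalColumnField {T : Type*} [TopologicalSpace T] [MeasurableSpace T]
    (μ : Measure T) (a : T → 𝓜(ℂ, A)) : Prop where
  continuous : Continuous a
  integrable : Integrable (fun t => star (a t) * a t) μ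
  integral_eq_one : ∫ t, star (a t) * a t ∂μ = 1

/-- The element `∫ a_t* x_t a_t dμ(t)` of `A`, as a Bochner integral. -/
noncomputable def columnMean {T : Type*} [MeasurableSpace T] (μ : Measure T)
    (a : T → 𝓜(ℂ, A)) (x : T → A) : A :=
  ∫ t, sandwich (a t) (x t) ∂μ

end

section

variable {A : Type*} [NonUnitalCStarAlgebra A] [PartialOrder A] [StarOrderedRing A]

/-- `y` lies in the centralizer of the positive functional `φ`. -/
def InCentralizer (φ : A →ₚ[ℂ] ℂ) (y : A) : Prop :=
  ∀ x : A, φ (x * y) = φ (y * x)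

/-- The canonical (strictly continuous) extension of a positive functional from `A` to `M(A)`:
`φ(m) = lim φ(m e)`, where `e` runs through the canonical approximate unit of `A`. -/
noncomputable def extend (φ : A →ₚ[ℂ] ℂ) (m : 𝓜(ℂ, A)) : ℂ :=
  limUnder (CStarAlgebra.approximateUnit A) (fun e : A => φ (m.fst e))

/-- The limit that defines `extend φ m` exists. -/
theorem tendsto_extend (φ : A →ₚ[ℂ] ℂ) (m : 𝓜(ℂ, A)) :
    Tendsto (fun e : A => φ (m.fst e)) (CStarAlgebra.approximateUnit A) (𝓝 (extend φ m)) := by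
  obtain ⟨C, hC⟩ := PositiveLinearMap.exists_norm_apply_le φ
  have hre : ∀ z : A, (φ z).re ≤ C * ‖z‖ := fun z => (Complex.re_le_norm _).trans (hC z)
  have hre0 : ∀ z : A, 0 ≤ z → 0 ≤ (φ z).re := fun z hz =>
    (Complex.nonneg_iff.mp (φ.map_nonneg hz)).1
  -- Cauchy-Schwarz
  have hCS : ∀ d : A, 0 ≤ d → ‖d‖ ≤ 2 →
      ‖φ (m.fst d)‖ ≤ √(C * (‖m‖ ^ 2 * 2)) * √((φ d).re) := by
    intro d hd hd2
    set b := CFC.sqrt d with hb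
    have hbb : b * b = d := CFC.sqrt_mul_sqrt_self d hd
    have hbs : star b = b := (CFC.sqrt_nonneg d).isSelfAdjoint
    have hbn : ‖b‖ ^ 2 = ‖d‖ := by
      rw [sq, ← CStarRing.norm_star_mul_self, hbs, hbb]
    have h := norm_inner_le_norm (𝕜 := ℂ) (φ.toPreGNS (star (m.fst b))) (φ.toPreGNS b)
    rw [PositiveLinearMap.preGNS_inner_def, PositiveLinearMap.preGNS_norm_def,
      PositiveLinearMap.preGNS_norm_def] at h
    simp only [PositiveLinearMap.ofPreGNS_toPreGNS, star_star, hbs, hbb] at h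
    rw [fst_mul, hbb] at h
    refine h.trans ?_
    gcongr
    refine (hre _).trans ?_
    gcongr
    calc ‖m.fst b * star (m.fst b)‖ = ‖m.fst b‖ ^ 2 := by
          rw [CStarRing.norm_self_mul_star, sq]
      _ ≤ (‖m‖ * ‖b‖) ^ 2 := by
          gcongr
          exact (m.fst.le_opNorm b).trans_eq (by rw [DoubleCentralizer.norm_fst])
      _ = ‖m‖ ^ 2 * ‖d‖ := by rw [mul_pow, hbn]
      _ ≤ ‖m‖ ^ 2 * 2 := by gcongr
  -- the values of `φ` are almost maximal far out in the approximate unit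
  have hsup : ∀ ε : ℝ, 0 < ε → ∃ a : A, (0 ≤ a ∧ ‖a‖ < 1) ∧
      ∀ e : A, a ≤ e → ‖e‖ ≤ 1 → (φ (e - a)).re ≤ ε := by
    intro ε hε
    set S : Set ℝ := {r | ∃ a : A, 0 ≤ a ∧ ‖a‖ ≤ 1 ∧ (φ a).re = r} with hS
    have hSb : BddAbove S := by
      refine ⟨C, ?_⟩
      rintro _ ⟨a, -, ha, rfl⟩
      exact (hre a).trans (mul_le_of_le_one_right C.2 ha)
    have hSn : S.Nonempty := ⟨0, 0, le_rfl, by simp, by simp⟩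
    obtain ⟨_, ⟨a, ha0, ha1, rfl⟩, ha⟩ := exists_lt_of_lt_csSup hSn
      (show sSup S - ε / 2 < sSup S by linarith)
    set δ : ℝ := ε / (2 * (C + 1) + ε) with hδ
    have hCp : (0 : ℝ) ≤ C := C.2
    have hδ0 : 0 < δ := by positivity
    have hδ1 : δ < 1 := by
      rw [hδ, div_lt_one (by positivity)]
      linarith
    have hδC : δ * C ≤ ε / 2 := by
      rw [hδ, div_mul_eq_mul_div, div_le_div_iff₀ (by positivity) (by positivity)]
      nlinarith
    have hra : (φ ((1 - δ) • a)).re = (1 - δ) * (φ a).re := by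
      rw [← Complex.coe_smul, map_smul]
      simp
    refine ⟨(1 - δ) • a, ⟨smul_nonneg (by linarith) ha0, ?_⟩, ?_⟩
    · rw [norm_smul, Real.norm_of_nonneg (by linarith)]
      nlinarith [norm_nonneg a]
    · intro e hae he
      have h0 : 0 ≤ e := (smul_nonneg (by linarith) ha0).trans hae
      have h1 : (φ e).re ≤ sSup S := le_csSup hSb ⟨e, h0, he, rfl⟩
      have h2 : (φ a).re ≤ C := (hre a).trans (mul_le_of_le_one_right C.2 ha1)
      rw [map_sub, Complex.sub_re, hra]
      nlinarith
  have hbasis := CStarAlgebra.hasBasis_approximateUnit A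
  have hne : (CStarAlgebra.approximateUnit A).NeBot :=
    (CStarAlgebra.increasingApproximateUnit A).neBot
  refine tendsto_nhds_limUnder ((cauchy_map_iff_exists_tendsto).mp ?_)
  rw [Metric.cauchy_iff]
  refine ⟨inferInstance, fun ε hε => ?_⟩
  set K : ℝ := √(C * (‖m‖ ^ 2 * 2)) with hK
  have hK0 : 0 ≤ K := Real.sqrt_nonneg _
  obtain ⟨a, ha, hae⟩ := hsup ((ε / (2 * (K + 1))) ^ 2) (by positivity)
  refine ⟨_, image_mem_map (hbasis.mem_of_mem ha), ?_⟩
  have main : ∀ e ∈ {x : A | a ≤ x} ∩ Metric.closedBall 0 1,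
      dist (φ (m.fst e)) (φ (m.fst a)) < ε / 2 := by
    rintro e ⟨h1, h2⟩
    have h1 : a ≤ e := h1
    have h2 : ‖e‖ ≤ 1 := by simpa using h2
    have h3 : ‖e - a‖ ≤ 2 := (norm_sub_le _ _).trans (by linarith [ha.2])
    have h4 : √((φ (e - a)).re) ≤ ε / (2 * (K + 1)) :=
      Real.sqrt_le_iff.mpr ⟨by positivity, hae e h1 h2⟩
    rw [dist_eq_norm, ← map_sub, ← map_sub]
    refine (hCS _ (sub_nonneg.mpr h1) h3).trans_lt ?_
    calc K * √((φ (e - a)).re) ≤ K * (ε / (2 * (K + 1))) := by gcongr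
      _ < (K + 1) * (ε / (2 * (K + 1))) := by
          have : 0 < ε / (2 * (K + 1)) := by positivity
          nlinarith
      _ = ε / 2 := by field_simp
  rintro _ ⟨e, he, rfl⟩ _ ⟨e', he', rfl⟩
  calc _ ≤ dist (φ (m.fst e)) (φ (m.fst a)) + dist (φ (m.fst e')) (φ (m.fst a)) :=
        dist_triangle_right _ _ _
    _ < ε := by linarith [main e he, main e' he']

/-- `extend φ` extends `φ`. -/
theorem extend_coe (φ : A →ₚ[ℂ] ℂ) (x : A) : extend φ (x : 𝓜(ℂ, A)) = φ x := by
  have hne : (CStarAlgebra.approximateUnit A).NeBot :=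
    (CStarAlgebra.increasingApproximateUnit A).neBot
  refine tendsto_nhds_unique (tendsto_extend φ (x : 𝓜(ℂ, A))) ?_
  have h := (CStarAlgebra.increasingApproximateUnit A).tendsto_mul_left x
  have hc : Continuous φ := map_continuous φ
  exact (hc.tendsto x).comp h

/-- A (possibly unbounded) positive functional on `A`: an additive and positively homogeneous
map on `A₊` with values in `[0, ∞]`. -/
structure Weight (A : Type*) [NonUnitalCStarAlgebra A] [PartialOrder A] [StarOrderedRing A] where
  toFun : {x : A // 0 ≤ x} → ℝ≥0∞
  map_add : ∀ x y, toFun (x + y) = toFun x + toFun y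
  map_smul : ∀ (c : ℝ≥0) (x : {x : A // 0 ≤ x}),
    toFun ⟨(c : ℝ) • x.1, smul_nonneg c.2 x.2⟩ = (c : ℝ≥0∞) * toFun x

variable (A) in
/-- The minimal dense ideal of `A`. Its positive part consists of the positive elements that are
dominated by a finite sum of elements `z ∈ A₊` for which there is `e ∈ A₊` with `z = z e`, and
the ideal is the linear span of its positive part. -/
def pedersenIdeal : Submodule ℂ A :=
  Submodule.span ℂ
    {x : A | 0 ≤ x ∧
      ∃ s ∈ AddSubmonoid.closure {z : A | 0 ≤ z ∧ ∃ e : A, 0 ≤ e ∧ z = z * e}, x ≤ s}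

namespace Weight

/-- `φ` is finite on (the positive part of) the minimal dense ideal. -/
def FiniteOnPedersenIdeal (φ : Weight A) : Prop :=
  ∀ x : {x : A // 0 ≤ x}, (x : A) ∈ pedersenIdeal A → φ.toFun x < ∞

/-- The linear functional on the minimal dense ideal that is determined by a weight which is
finite there, computed through `z = (Re z)⁺ - (Re z)⁻ + i ((Im z)⁺ - (Im z)⁻)`.
It is only used on the minimal dense ideal, which contains these four parts with `z`. -/
noncomputable def linearExtension (φ : Weight A) (z : A) : ℂ :=
  (((φ.toFun ⟨((ℜ z : A))⁺, CFC.posPart_nonneg _⟩).toReal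
    - (φ.toFun ⟨((ℜ z : A))⁻, CFC.negPart_nonneg _⟩).toReal : ℝ) : ℂ)
  + (((φ.toFun ⟨((ℑ z : A))⁺, CFC.posPart_nonneg _⟩).toReal
    - (φ.toFun ⟨((ℑ z : A))⁻, CFC.negPart_nonneg _⟩).toReal : ℝ) : ℂ) * Complex.I

/-- `y` lies in the centralizer of the weight `φ`, which is finite on the minimal dense ideal. -/
def InCentralizer (φ : Weight A) (y : A) : Prop :=
  ∀ x ∈ pedersenIdeal A, φ.linearExtension (x * y) = φ.linearExtension (y * x)

/-- The canonical extension of a lower semicontinuous weight from `A₊` to `M(A)₊`: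
`φ(m) = sup {φ(x) : x ∈ A₊, x ≤ m}`. -/
noncomputable def extend (φ : Weight A) (m : 𝓜(ℂ, A)) : ℝ≥0∞ :=
  ⨆ (x : {x : A // 0 ≤ x}) (_ : ((x : A) : 𝓜(ℂ, A)) ≤ m), φ.toFun x

end Weight

end

end CStarJensen

/-! Let y be the column mean and w the integral of a_t* f(x_t) a_t. If an affine ℓ lies below f on
I, then ℓ(y) ≤ w, because ∫ a_t* a_t = 1 lets ℓ pass through the integral
(`affine_le_integral_cfc`). On the compact set sp(y), f is up to η at most ∑ k_i² ℓ_i with affine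
minorants ℓ_i and ∑ k_i² = 1 (`exists_partition_affine`). With q_i = k_i(y) this becomes the
operator inequality f(y) ≤ ∑ q_i w q_i + η, where ∑ q_i² = 1 (`exists_cfc_le_sum`).

If y is in the centralizer of a positive functional, so are the q_i for its extension to M(A); hence
the functional takes the same value at ∑ q_i w q_i and at w, and η → 0 gives (i).

For a weight, φ(1) may be infinite and φ(w) is only a supremum over A₊, so two substitutes are
needed. First, φ(∑ q_i z q_i) ≤ φ(z) for z in A₊ (`val_sum_sandwich_le`): equality on the minimal
dense ideal, then lower semicontinuity. Moving q_i across x there requires u ↦ φ(ux) to be norm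
continuous on M(A), which comes from Baire's theorem (`exists_val_sandwich_le`). Second, put B = ∑
q_i w q_i. For x in A₊ below f(y), √x is nearly Bv, where bvv*b ≤ b whenever 0 ≤ b ≤ B
(`exists_sqrt_eq_add`). Taking b = ∑ q_i √w e √w q_i with e in the approximate unit, lower
semicontinuity absorbs both e and η. -/

namespace CStarJensen

/-! ### The embedding of A into M(A) and the maps x ↦ u* x u. -/

section Multiplier

variable {A : Type*} [NonUnitalCStarAlgebra A]

@[simp]
theorem norm_coe (a : A) : ‖(a : 𝓜(ℂ, A))‖ = ‖a‖ := by
  rw [← DoubleCentralizer.norm_fst, DoubleCentralizer.coe_fst,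
    ContinuousLinearMap.opNorm_mul_apply]

/-- The embedding of `A` into `M(A)` as a linear isometry. -/
noncomputable def coeLI : A →ₗᵢ[ℂ] 𝓜(ℂ, A) where
  toFun a := a
  map_add' := map_add (DoubleCentralizer.coeHom (𝕜 := ℂ) (A := A))
  map_smul' := map_smul (DoubleCentralizer.coeHom (𝕜 := ℂ) (A := A))
  norm_map' := norm_coe

theorem coe_injective : Function.Injective (fun a : A => (a : 𝓜(ℂ, A))) :=
  (coeLI (A := A)).injective

theorem continuous_coe : Continuous (fun a : A => (a : 𝓜(ℂ, A))) :=
  (coeLI (A := A)).continuous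

theorem coe_add (a b : A) : ((a + b : A) : 𝓜(ℂ, A)) = a + b := map_add (coeLI (A := A)) a b

theorem coe_sub (a b : A) : ((a - b : A) : 𝓜(ℂ, A)) = a - b := map_sub (coeLI (A := A)) a b

theorem coe_smul (c : ℂ) (a : A) : ((c • a : A) : 𝓜(ℂ, A)) = c • (a : 𝓜(ℂ, A)) :=
  map_smul (coeLI (A := A)) c a

theorem coe_real_smul (c : ℝ) (a : A) : ((c • a : A) : 𝓜(ℂ, A)) = c • (a : 𝓜(ℂ, A)) :=
  coe_smul (c : ℂ) a

theorem coe_sum {ι : Type*} (s : Finset ι) (g : ι → A) :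
    ((∑ i ∈ s, g i : A) : 𝓜(ℂ, A)) = ∑ i ∈ s, (g i : 𝓜(ℂ, A)) := map_sum (coeLI (A := A)) g s

theorem coe_mul (a b : A) : ((a * b : A) : 𝓜(ℂ, A)) = a * b :=
  map_mul (DoubleCentralizer.coeHom (𝕜 := ℂ) (A := A)) a b

theorem coe_star (a : A) : ((star a : A) : 𝓜(ℂ, A)) = star (a : 𝓜(ℂ, A)) :=
  map_star (DoubleCentralizer.coeHom (𝕜 := ℂ) (A := A)) a

theorem mul_snd_apply (m : 𝓜(ℂ, A)) (u v : A) : u * m.snd v = m.snd (u * v) := by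
  have key : ∀ w : A, (u * m.snd v - m.snd (u * v)) * w = 0 := by
    intro w
    rw [sub_mul, mul_assoc, m.central, m.central, mul_assoc, sub_self]
  exact sub_eq_zero.mp (CStarRing.mul_star_self_eq_zero_iff _ |>.mp (key (star _)))

theorem coe_fst (m : 𝓜(ℂ, A)) (u : A) : ((m.fst u : A) : 𝓜(ℂ, A)) = m * u := by
  refine DoubleCentralizer.ext ℂ A _ _ (Prod.ext ?_ ?_)
  · refine ContinuousLinearMap.ext fun z => ?_
    simp only [DoubleCentralizer.coe_fst, DoubleCentralizer.mul_fst,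
      ContinuousLinearMap.mul_apply', mul_apply_eq_comp]
    rw [fst_mul]
  · refine ContinuousLinearMap.ext fun z => ?_
    simp only [DoubleCentralizer.coe_snd, DoubleCentralizer.mul_snd,
      ContinuousLinearMap.mul_apply', ContinuousLinearMap.flip_apply, mul_apply_eq_comp]
    rw [← m.central]

theorem coe_snd (m : 𝓜(ℂ, A)) (u : A) : ((m.snd u : A) : 𝓜(ℂ, A)) = u * m := by
  refine DoubleCentralizer.ext ℂ A _ _ (Prod.ext ?_ ?_)
  · refine ContinuousLinearMap.ext fun z => ?_
    simp only [DoubleCentralizer.coe_fst, DoubleCentralizer.mul_fst,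
      ContinuousLinearMap.mul_apply', mul_apply_eq_comp]
    rw [m.central]
  · refine ContinuousLinearMap.ext fun z => ?_
    simp only [DoubleCentralizer.coe_snd, DoubleCentralizer.mul_snd,
      ContinuousLinearMap.mul_apply', ContinuousLinearMap.flip_apply, mul_apply_eq_comp]
    rw [mul_snd_apply]

theorem norm_fst_apply_le (m : 𝓜(ℂ, A)) (u : A) : ‖m.fst u‖ ≤ ‖m‖ * ‖u‖ := by
  rw [← norm_coe, coe_fst, ← norm_coe u]
  exact norm_mul_le _ _

theorem sandwich_add (u : 𝓜(ℂ, A)) (x y : A) :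
    sandwich u (x + y) = sandwich u x + sandwich u y := by simp [sandwich]

theorem sandwich_sub (u : 𝓜(ℂ, A)) (x y : A) :
    sandwich u (x - y) = sandwich u x - sandwich u y := by simp [sandwich]

theorem sandwich_zero (u : 𝓜(ℂ, A)) : sandwich u 0 = 0 := by simp [sandwich]

theorem norm_sandwich_le (u : 𝓜(ℂ, A)) (x : A) : ‖sandwich u x‖ ≤ ‖x‖ * ‖star u * u‖ := by
  rw [← norm_coe, coe_sandwich, ← norm_coe x, CStarRing.norm_star_mul_self]
  calc _ ≤ ‖star u‖ * ‖(x : 𝓜(ℂ, A))‖ * ‖u‖ := norm_mul₃_le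
    _ = _ := by rw [norm_star]; ring

theorem continuous_sandwich : Continuous (fun p : 𝓜(ℂ, A) × A => sandwich p.1 p.2) := by
  rw [(coeLI (A := A)).isometry.isEmbedding.continuous_iff]
  have : (coeLI ∘ fun p : 𝓜(ℂ, A) × A => sandwich p.1 p.2) =
      fun p => star p.1 * (p.2 : 𝓜(ℂ, A)) * p.1 := by
    ext1 p; exact coe_sandwich _ _
  rw [this]
  have := continuous_coe (A := A)
  fun_prop

theorem sandwich_star_mul_self (u : 𝓜(ℂ, A)) (b : A) :
    sandwich u (star b * b) = star (u.snd b) * u.snd b := by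
  apply coe_injective
  simp only [coe_sandwich, coe_mul, coe_star, coe_snd, star_mul]
  noncomm_ring

theorem sandwich_smul (c : ℂ) (u : 𝓜(ℂ, A)) (x : A) :
    sandwich (c • u) x = (‖c‖ ^ 2 : ℝ) • sandwich u x := by
  apply coe_injective
  simp only [coe_sandwich, coe_real_smul, star_smul, smul_mul_assoc, mul_smul_comm, smul_smul]
  rw [← Complex.coe_smul]
  congr 1
  simp [Complex.mul_conj']

theorem sandwich_add_left_add_sandwich_sub_left (u v : 𝓜(ℂ, A)) (x : A) :
    sandwich (u + v) x + sandwich (u - v) x =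
      (2 : ℝ) • sandwich u x + (2 : ℝ) • sandwich v x := by
  apply coe_injective
  simp only [coe_sandwich, coe_add, star_add, star_sub, two_smul]
  noncomm_ring

/-- Reduces two-sided multiplication x ↦ v* x w to the positive maps x ↦ u* x u. -/
theorem polarization_sandwich (v w : 𝓜(ℂ, A)) (x : A) :
    (star v).fst (w.snd x) = (4 : ℂ)⁻¹ • (sandwich (v + w) x - sandwich (v - w) x
      - Complex.I • sandwich (v + Complex.I • w) x + Complex.I • sandwich (v - Complex.I • w) x) := by
  rw [eq_inv_smul_iff₀ (by norm_num)]
  apply coe_injective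
  simp only [coe_sandwich, coe_add, coe_sub, coe_smul, coe_fst, coe_snd, star_add, star_sub,
    star_smul, mul_add, add_mul, mul_sub, sub_mul, smul_mul_assoc, mul_smul_comm, smul_add,
    smul_sub, smul_smul, Complex.star_def, Complex.conj_I, Complex.I_mul_I, neg_smul,
    neg_mul, mul_assoc]
  match_scalars <;> ring_nf
  norm_num [Complex.I_sq]

theorem coe_isSelfAdjoint_iff {a : A} : IsSelfAdjoint (a : 𝓜(ℂ, A)) ↔ IsSelfAdjoint a := by
  rw [isSelfAdjoint_iff, isSelfAdjoint_iff, ← coe_star, coe_injective.eq_iff]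

variable [PartialOrder A] [StarOrderedRing A]

theorem sandwich_nonneg (u : 𝓜(ℂ, A)) {x : A} (hx : 0 ≤ x) : 0 ≤ sandwich u x := by
  obtain ⟨b, rfl⟩ := CStarAlgebra.nonneg_iff_eq_star_mul_self.mp hx
  rw [sandwich_star_mul_self]
  exact star_mul_self_nonneg _

theorem sandwich_mono (u : 𝓜(ℂ, A)) {x y : A} (h : x ≤ y) : sandwich u x ≤ sandwich u y := by
  rw [← sub_nonneg, ← sandwich_sub]
  exact sandwich_nonneg u (sub_nonneg.mpr h)

theorem coe_nonneg {a : A} (ha : 0 ≤ a) : 0 ≤ (a : 𝓜(ℂ, A)) := by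
  obtain ⟨b, rfl⟩ := CStarAlgebra.nonneg_iff_eq_star_mul_self.mp ha
  rw [coe_mul, coe_star]
  exact star_mul_self_nonneg _

theorem star_mul_fst_mul_nonneg {m : 𝓜(ℂ, A)} (hm : 0 ≤ m) (v : A) : 0 ≤ star v * m.fst v := by
  obtain ⟨n, rfl⟩ := CStarAlgebra.nonneg_iff_eq_star_mul_self.mp hm
  have : star v * (star n * n).fst v = star (n.fst v) * n.fst v := by
    apply coe_injective
    simp only [coe_mul, coe_star, coe_fst, star_mul]
    noncomm_ring
  rw [this]
  exact star_mul_self_nonneg _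

/-- For the nontrivial direction, the compressions e* a e are positive in A and tend to a along the
approximate unit. -/
theorem coe_nonneg_iff {a : A} : 0 ≤ (a : 𝓜(ℂ, A)) ↔ 0 ≤ a := by
  refine ⟨fun h => ?_, coe_nonneg⟩
  have hl := CStarAlgebra.increasingApproximateUnit A
  have hne := hl.neBot
  refine ge_of_tendsto (x := CStarAlgebra.approximateUnit A) (f := fun e : A => star e * (a * e)) ?_
    (Eventually.of_forall fun e => by simpa using star_mul_fst_mul_nonneg h e)
  have h1 : Tendsto (fun e : A => e * (a * e)) (CStarAlgebra.approximateUnit A) (𝓝 a) := by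
    have h2 := hl.tendsto_mul_left a
    have h3 := hl.tendsto_mul_right a
    have h4 : Tendsto (fun e : A => e * (a * e - a)) (CStarAlgebra.approximateUnit A) (𝓝 0) := by
      refine squeeze_zero_norm' (a := fun e => ‖a * e - a‖) ?_ ?_
      · filter_upwards [hl.eventually_norm] with e he
        exact (norm_mul_le _ _).trans (mul_le_of_le_one_left (norm_nonneg _) he)
      · simpa using (h2.sub_const a).norm
    simpa [mul_sub] using h4.add h3
  refine h1.congr' ?_
  filter_upwards [hl.eventually_star_eq] with e he
  rw [he]

theorem coe_le_coe_iff {a b : A} : (a : 𝓜(ℂ, A)) ≤ b ↔ a ≤ b := by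
  rw [← sub_nonneg, ← coe_sub, coe_nonneg_iff, sub_nonneg]

end Multiplier

end CStarJensen

namespace CStarJensen

/-! ### Bochner integrals of continuous functions against a Radon measure. -/

section Integration

variable {T : Type*} [TopologicalSpace T] [T2Space T] [MeasurableSpace T] [BorelSpace T]

/-- A continuous function is strongly measurable with respect to the restriction of a measure to a
compact set. -/
theorem aestronglyMeasurable_restrict_of_isCompact {E : Type*} [NormedAddCommGroup E]
    (μ : Measure T) {F : T → E} (hF : Continuous F) {K : Set T} (hK : IsCompact K) :
    AEStronglyMeasurable F (μ.restrict K) :=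
  hF.continuousOn.aestronglyMeasurable_of_isCompact hK hK.measurableSet

/-- For a Radon measure, the complement of the zero set of a continuous integrable function is
covered by countably many compact sets up to a null set. -/
theorem exists_isCompact_cover_support {E : Type*} [NormedAddCommGroup E] (μ : Measure T)
    [μ.Regular] {G : T → E} (hG : Continuous G) (hGi : Integrable G μ) :
    ∃ K : ℕ → Set T, (∀ n, IsCompact (K n)) ∧ ∀ᵐ t ∂μ, G t ≠ 0 → ∃ n, t ∈ K n := by
  -- These level sets exhaust the set where G ≠ 0 and have finite measure, so each is exhausted by
  -- compact sets up to a null set.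
  have hU : ∀ n : ℕ, IsOpen {t | (1 : ℝ) / (n + 1) < ‖G t‖} := fun n =>
    isOpen_lt continuous_const hG.norm
  have hfin : ∀ n : ℕ, μ {t | (1 : ℝ) / (n + 1) < ‖G t‖} ≠ ∞ := fun n =>
    ((measure_mono (show {t | (1 : ℝ) / (n + 1) < ‖G t‖} ⊆ {t | (1 : ℝ) / (n + 1) ≤ ‖G t‖} from
      fun t (ht : (1 : ℝ) / (n + 1) < ‖G t‖) => ht.le)).trans_lt
      (hGi.measure_norm_ge_lt_top (ε := 1 / (n + 1)) (by positivity))).ne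
  have hK : ∀ n m : ℕ, ∃ K ⊆ {t | (1 : ℝ) / (n + 1) < ‖G t‖}, IsCompact K ∧
      μ ({t | (1 : ℝ) / (n + 1) < ‖G t‖} \ K) < (m + 1 : ℝ≥0∞)⁻¹ := fun n m =>
    (hU n).measurableSet.exists_isCompact_sdiff_lt (hfin n) (by simp)
  choose K hKU hKc hKμ using hK
  refine ⟨fun k => K k.unpair.1 k.unpair.2, fun k => hKc _ _, ?_⟩
  have hnull : ∀ n : ℕ, μ ({t | (1 : ℝ) / (n + 1) < ‖G t‖} \ ⋃ m, K n m) = 0 := by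
    intro n
    refine le_antisymm (ENNReal.le_of_forall_pos_le_add fun ε hε _ => ?_) zero_le
    obtain ⟨m, hm⟩ := ENNReal.exists_inv_nat_lt (a := (ε : ℝ≥0∞)) (by positivity)
    rw [zero_add]
    calc _ ≤ μ ({t | (1 : ℝ) / (n + 1) < ‖G t‖} \ K n m) :=
          measure_mono (Set.sdiff_subset_sdiff_right (Set.subset_iUnion _ m))
      _ ≤ (m + 1 : ℝ≥0∞)⁻¹ := (hKμ n m).le
      _ ≤ (m : ℝ≥0∞)⁻¹ := ENNReal.inv_le_inv.mpr le_self_add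
      _ ≤ ε := hm.le
  have : ∀ᵐ t ∂μ, ∀ n : ℕ, t ∉ ({t | (1 : ℝ) / (n + 1) < ‖G t‖} \ ⋃ m, K n m) :=
    ae_all_iff.mpr fun n => measure_eq_zero_iff_ae_notMem.mp (hnull n)
  filter_upwards [this] with t ht hGt
  obtain ⟨n, hn⟩ := exists_nat_one_div_lt (norm_pos_iff.mpr hGt)
  have := ht n
  simp only [Set.mem_sdiff, Set.mem_ofPred_eq, hn, true_and, not_not, Set.mem_iUnion] at this
  obtain ⟨m, hm⟩ := this
  exact ⟨Nat.pair n m, by simpa using hm⟩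

/-- Without second countability, continuity gives strong measurability only on compact sets, where
the range is separable. Countably many of them suffice, since F vanishes almost everywhere off their
union. -/
theorem aestronglyMeasurable_of_eq_zero {E E' : Type*} [NormedAddCommGroup E]
    [NormedAddCommGroup E'] (μ : Measure T) [μ.Regular] {G : T → E} (hG : Continuous G)
    (hGi : Integrable G μ) {F : T → E'} (hF : Continuous F) (h0 : ∀ t, G t = 0 → F t = 0) :
    AEStronglyMeasurable F μ := by
  obtain ⟨K, hK, hcov⟩ := exists_isCompact_cover_support μ hG hGi
  have hm : MeasurableSet (⋃ n, K n) := .iUnion fun n => (hK n).measurableSet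
  have h1 : AEStronglyMeasurable F (μ.restrict (⋃ n, K n)) :=
    aestronglyMeasurable_iUnion_iff.mpr fun n =>
      aestronglyMeasurable_restrict_of_isCompact μ hF (hK n)
  refine ((aestronglyMeasurable_indicator_iff hm).mpr h1).congr ?_
  filter_upwards [hcov] with t ht
  by_cases htK : t ∈ ⋃ n, K n
  · rw [Set.indicator_of_mem htK]
  · rw [Set.indicator_of_notMem htK, h0]
    by_contra hG0
    exact htK (Set.mem_iUnion.mpr (ht hG0))

/-- A continuous function that is dominated by a multiple of a continuous integrable function is
integrable with respect to a Radon measure. -/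
theorem integrable_of_continuous_of_norm_le {E E' : Type*} [NormedAddCommGroup E]
    [NormedAddCommGroup E'] (μ : Measure T) [μ.Regular] {G : T → E} (hG : Continuous G)
    (hGi : Integrable G μ) {F : T → E'} (hF : Continuous F) (C : ℝ)
    (h : ∀ t, ‖F t‖ ≤ C * ‖G t‖) : Integrable F μ := by
  refine (hGi.norm.const_mul C).mono' (aestronglyMeasurable_of_eq_zero μ hG hGi hF fun t ht => ?_)
    (Eventually.of_forall h)
  simpa [ht] using h t

/-- For a Radon measure, the integral of a continuous integrable function is nearly concentrated
on a compact set. -/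
theorem exists_isCompact_norm_integral_sub_lt {E : Type*} [NormedAddCommGroup E] [NormedSpace ℝ E]
    (μ : Measure T) [μ.Regular] {G : T → E} (hG : Continuous G)
    (hGi : Integrable G μ) {ε : ℝ} (hε : 0 < ε) :
    ∃ K, IsCompact K ∧ ‖(∫ t, G t ∂μ) - ∫ t in K, G t ∂μ‖ < ε := by
  obtain ⟨K, hK, hcov⟩ := exists_isCompact_cover_support μ hG hGi
  have hmono : Monotone (fun n => ⋃ k ∈ Finset.range n, K k) := fun m n hmn =>
    Set.biUnion_subset_biUnion_left fun k hk => by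
      simp only [Finset.coe_range, Set.mem_Iio] at hk ⊢; omega
  have hc : ∀ n, IsCompact (⋃ k ∈ Finset.range n, K k) := fun n =>
    (Finset.range n).isCompact_biUnion fun k _ => hK k
  have hU : (⋃ n, ⋃ k ∈ Finset.range n, K k) = ⋃ n, K n := by
    ext t
    simp only [Set.mem_iUnion, Finset.mem_range]
    exact ⟨fun ⟨_, k, _, h⟩ => ⟨k, h⟩, fun ⟨k, h⟩ => ⟨k + 1, k, by omega, h⟩⟩
  have ht := tendsto_setIntegral_of_monotone (μ := μ) (f := G) (fun n => (hc n).measurableSet) hmono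
    hGi.integrableOn
  have hall : ∫ t in ⋃ n, ⋃ k ∈ Finset.range n, K k, G t ∂μ = ∫ t, G t ∂μ := by
    rw [hU]
    refine setIntegral_eq_integral_of_ae_compl_eq_zero ?_
    filter_upwards [hcov] with t ht htK
    by_contra h
    exact htK (Set.mem_iUnion.mpr (ht h))
  rw [hall] at ht
  obtain ⟨n, hn⟩ := ((Metric.tendsto_nhds.mp ht) ε hε).exists
  exact ⟨_, hc n, by rwa [dist_eq_norm, norm_sub_rev] at hn⟩

end Integration

end CStarJensen

namespace CStarJensen

/-! ### Affine minorants of a convex function. -/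

section Convex

/-- At an endpoint the graph may be vertical, as for -√t at 0, so there may be no supporting line;
hence the slack ε. Within δ of s, continuity and a nonpositive slope suffice; farther away, secant
slopes dominate the one to s + δ/2. -/
theorem exists_slope_le_right {I : Set ℝ} {f : ℝ → ℝ} (hf : ContinuousOn f I)
    (hfc : ConvexOn ℝ I f) {s : ℝ} (hs : s ∈ I) {ε : ℝ} (hε : 0 < ε) :
    ∃ m : ℝ, ∀ t ∈ I, s < t → m * (t - s) ≤ f t - f s + ε := by
  obtain ⟨δ, hδ, h⟩ := Metric.continuousOn_iff.mp hf s hs ε hε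
  refine ⟨min 0 ((f (s + δ / 2) - f s) / (s + δ / 2 - s)), fun t ht hst => ?_⟩
  have hts : 0 < t - s := sub_pos.mpr hst
  rcases lt_or_ge (t - s) δ with htδ | htδ
  · have h1 := h t ht (by rwa [Real.dist_eq, abs_of_pos hts])
    rw [Real.dist_eq, abs_lt] at h1
    have : min 0 ((f (s + δ / 2) - f s) / (s + δ / 2 - s)) * (t - s) ≤ 0 :=
      mul_nonpos_of_nonpos_of_nonneg (min_le_left _ _) hts.le
    linarith
  · have hmem : s + δ / 2 ∈ I := hfc.1.ordConnected.out hs ht ⟨by linarith, by linarith⟩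
    have h2 := hfc.secant_mono hs hmem ht (by linarith : s + δ / 2 ≠ s |> fun _ => s < s + δ / 2).ne'
      hst.ne' (by linarith)
    calc _ ≤ (f t - f s) / (t - s) * (t - s) := by
          gcongr
          exact (min_le_right _ _).trans h2
      _ ≤ _ := by rw [div_mul_cancel₀ _ hts.ne']; linarith

theorem exists_slope_le_left {I : Set ℝ} {f : ℝ → ℝ} (hf : ContinuousOn f I)
    (hfc : ConvexOn ℝ I f) {s : ℝ} (hs : s ∈ I) {ε : ℝ} (hε : 0 < ε) :
    ∃ m : ℝ, ∀ t ∈ I, t < s → m * (t - s) ≤ f t - f s + ε := by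
  set N : ℝ →ₗ[ℝ] ℝ := -LinearMap.id with hN
  obtain ⟨m, hm⟩ := exists_slope_le_right (I := N ⁻¹' I) (f := f ∘ N) (s := -s)
    (hf.comp (t := I) (by rw [hN]; exact continuous_neg.continuousOn) fun x hx => hx)
    (hfc.comp_linearMap N) (by simpa [hN] using hs) hε
  refine ⟨-m, fun t ht hts => ?_⟩
  have := hm (-t) (by simpa [hN] using ht) (by linarith)
  simp only [hN, Function.comp_apply, LinearMap.neg_apply, LinearMap.id_apply, neg_neg] at this
  linarith

/-- A continuous convex function on an interval is the pointwise supremum of its affine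
minorants. -/
theorem exists_affine_le {I : Set ℝ} {f : ℝ → ℝ} (hf : ContinuousOn f I)
    (hfc : ConvexOn ℝ I f) {s : ℝ} (hs : s ∈ I) {ε : ℝ} (hε : 0 < ε) :
    ∃ c d : ℝ, (∀ t ∈ I, c * t + d ≤ f t) ∧ f s - ε < c * s + d := by
  suffices h : ∃ c : ℝ, ∀ t ∈ I, c * (t - s) ≤ f t - f s + ε / 2 by
    obtain ⟨c, hc⟩ := h
    exact ⟨c, f s - ε / 2 - c * s, fun t ht => by linarith [hc t ht], by linarith⟩
  obtain ⟨m, hm⟩ := exists_slope_le_right hf hfc hs (half_pos hε)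
  obtain ⟨m', hm'⟩ := exists_slope_le_left hf hfc hs (half_pos hε)
  by_cases hR : ∃ r ∈ I, s < r
  · obtain ⟨r, hr, hsr⟩ := hR
    by_cases hL : ∃ l ∈ I, l < s
    · obtain ⟨l, hl, hls⟩ := hL
      have key : ∀ u ∈ I, u < s → ∀ v ∈ I, s < v → (f s - f u) / (s - u) ≤ (f v - f s) / (v - s) :=
        fun u hu hus v hv hsv => hfc.slope_mono_adjacent hu hv hus hsv
      -- At an interior point every left secant slope is at most every right one; the supremum of
      -- the left ones is the slope of a supporting line.
      set S : Set ℝ := {r | ∃ u ∈ I, u < s ∧ r = (f s - f u) / (s - u)} with hS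
      have hne : S.Nonempty := ⟨_, l, hl, hls, rfl⟩
      have hub : ∀ v ∈ I, s < v → (f v - f s) / (v - s) ∈ upperBounds S := by
        rintro v hv hsv _ ⟨u, hu, hus, rfl⟩
        exact key u hu hus v hv hsv
      refine ⟨sSup S, fun t ht => ?_⟩
      rcases lt_trichotomy t s with h | h | h
      · have h1 : (f s - f t) / (s - t) ≤ sSup S :=
          le_csSup ⟨_, hub r hr hsr⟩ ⟨t, ht, h, rfl⟩
        rw [div_le_iff₀ (by linarith)] at h1
        linarith
      · subst h; simp; positivity
      · have h1 : sSup S ≤ (f t - f s) / (t - s) := csSup_le hne (hub t ht h)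
        rw [le_div_iff₀ (by linarith)] at h1
        linarith
    · push Not at hL
      refine ⟨m, fun t ht => ?_⟩
      rcases (hL t ht).eq_or_lt with h | h
      · subst h; simp; positivity
      · exact hm t ht h
  · push Not at hR
    refine ⟨m', fun t ht => ?_⟩
    rcases (hR t ht).eq_or_lt with h | h
    · subst h; simp; positivity
    · exact hm' t ht h

/-- On a compact set, a continuous convex function is up to `η` at most a combination of affine
minorants, the coefficients being the squares of continuous functions and summing up to `1`. -/
theorem exists_partition_affine {I : Set ℝ} {f : ℝ → ℝ} (hf : ContinuousOn f I)
    (hfc : ConvexOn ℝ I f) {σ : Set ℝ} (hσ : IsCompact σ) (hσI : σ ⊆ I) {η : ℝ} (hη : 0 < η) :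
    ∃ (F : Finset ℝ) (k : ℝ → ℝ → ℝ) (c d : ℝ → ℝ), (∀ i ∈ F, ContinuousOn (k i) σ) ∧
      (∀ i ∈ F, ∀ t ∈ I, c i * t + d i ≤ f t) ∧
      (∀ t ∈ σ, ∑ i ∈ F, k i t * k i t = 1) ∧
      ∀ t ∈ σ, f t ≤ ∑ i ∈ F, k i t * (c i * t + d i) * k i t + η := by
  have h : ∀ s, ∃ c d : ℝ, s ∈ I → (∀ t ∈ I, c * t + d ≤ f t) ∧ f s - η < c * s + d := by
    intro s
    by_cases hs : s ∈ I
    · obtain ⟨c, d, h⟩ := exists_affine_le hf hfc hs hη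
      exact ⟨c, d, fun _ => h⟩
    · exact ⟨0, 0, fun h => absurd h hs⟩
  choose c d hcd using h
  set g : ℝ → ℝ → ℝ := fun i t => c i * t + d i - f t + η with hg
  have hgc : ∀ i, ContinuousOn (g i) σ := fun i => by
    have := hf.mono hσI
    fun_prop
  obtain ⟨F, hFσ, hF⟩ := hσ.elim_nhdsWithin_subcover (fun i => {t | 0 < g i t}) fun s hs =>
    (hgc s s hs).eventually (lt_mem_nhds (by have := (hcd s (hσI hs)).2; simp only [hg]; linarith))
  -- The normalised positive parts of the `g i` form a partition of unity; the i-th one is nonzero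
  -- only where the i-th minorant exceeds f - η. Its square roots serve as the `k i`.
  set S : ℝ → ℝ := fun t => ∑ i ∈ F, max (g i t) 0 with hS
  have hSpos : ∀ t ∈ σ, 0 < S t := fun t ht => by
    obtain ⟨i, hi, hit⟩ := Set.mem_iUnion₂.mp (hF ht)
    exact Finset.sum_pos' (fun _ _ => le_max_right _ _) ⟨i, hi, lt_max_of_lt_left hit⟩
  have hSc : ContinuousOn S σ :=
    continuousOn_finsetSum _ fun i _ => (hgc i).sup continuousOn_const
  have hsq : ∀ i, ∀ t ∈ σ, √(max (g i t) 0 / S t) * √(max (g i t) 0 / S t) = max (g i t) 0 / S t :=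
    fun i t ht => Real.mul_self_sqrt (div_nonneg (le_max_right _ _) (hSpos t ht).le)
  have hsum : ∀ t ∈ σ, ∑ i ∈ F, max (g i t) 0 / S t = 1 := fun t ht => by
    rw [← Finset.sum_div, div_self (hSpos t ht).ne']
  refine ⟨F, fun i t => √(max (g i t) 0 / S t), c, d, fun i _ => ?_,
    fun i hi => (hcd i (hσI (hFσ i hi))).1, fun t ht => ?_, fun t ht => ?_⟩
  · exact (((hgc i).sup continuousOn_const).div hSc fun t ht => (hSpos t ht).ne').sqrt
  · rw [Finset.sum_congr rfl fun i _ => hsq i t ht, hsum t ht]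
  · calc f t = ∑ i ∈ F, max (g i t) 0 / S t * (f t - η) + η := by
          rw [← Finset.sum_mul, hsum t ht]; ring
      _ ≤ _ := by
          refine add_le_add_left (Finset.sum_le_sum fun i hi => ?_) _
          rw [mul_right_comm, hsq i t ht]
          rcases le_or_gt (g i t) 0 with h | h
          · simp [max_eq_right h]
          · gcongr
            simp only [hg] at h
            linarith

end Convex

/-! ### The operator inequality for f(y). -/

section Operator

variable {B : Type*} [CStarAlgebra B] [PartialOrder B] [StarOrderedRing B]

/-- If `w` dominates `ℓ(y)` for all affine minorants `ℓ` of the convex function `f`, then `f(y)` is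
up to `η` at most an average `∑ qᵢ w qᵢ` with elements `qᵢ` of the C*-algebra generated by `y`. -/
theorem exists_cfc_le_sum {I : Set ℝ} {f : ℝ → ℝ} (hf : ContinuousOn f I)
    (hfc : ConvexOn ℝ I f) {y w : B} (hy : IsSelfAdjoint y) (hyI : spectrum ℝ y ⊆ I)
    (hw : ∀ c d : ℝ, (∀ t ∈ I, c * t + d ≤ f t) → c • y + d • (1 : B) ≤ w) {η : ℝ} (hη : 0 < η) :
    ∃ (F : Finset ℝ) (k : ℝ → ℝ → ℝ), (∀ i ∈ F, ContinuousOn (k i) (spectrum ℝ y)) ∧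
      ∑ i ∈ F, cfc (k i) y * cfc (k i) y = 1 ∧
      cfc f y ≤ ∑ i ∈ F, cfc (k i) y * w * cfc (k i) y + η • (1 : B) := by
  obtain ⟨F, k, c, d, hk, hcd, hk1, hkf⟩ := exists_partition_affine hf hfc
    (ContinuousFunctionalCalculus.isCompact_spectrum (R := ℝ) y) hyI hη
  refine ⟨F, k, hk, ?_, ?_⟩
  · calc _ = ∑ i ∈ F, cfc (fun t => k i t * k i t) y :=
          Finset.sum_congr rfl fun i hi => (cfc_mul _ _ y (hk i hi) (hk i hi)).symm
      _ = cfc (fun t => ∑ i ∈ F, k i t * k i t) y := by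
          rw [← cfc_sum (fun i t => k i t * k i t) y F fun i hi => (hk i hi).mul (hk i hi)]
          congr 1; ext t; simp
      _ = 1 := by
          rw [cfc_congr (g := fun _ => (1 : ℝ)) hk1, cfc_const_one ℝ y]
  · have hℓ : ∀ i, c i • y + d i • (1 : B) = cfc (fun t => c i * t + d i) y := fun i => by
      rw [cfc_add_const (d i) (fun t => c i * t) y, cfc_const_mul_id (c i) y,
        Algebra.algebraMap_eq_smul_one]
    have hs : ∀ i ∈ F, ContinuousOn (fun t => k i t * (c i * t + d i) * k i t) (spectrum ℝ y) :=
      fun i hi => ((hk i hi).mul (by fun_prop)).mul (hk i hi)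
    calc cfc f y ≤ cfc (fun t => ∑ i ∈ F, k i t * (c i * t + d i) * k i t + η) y := by
          refine cfc_mono hkf (hf.mono hyI) ?_
          exact (continuousOn_finsetSum _ hs).add continuousOn_const
      _ = ∑ i ∈ F, cfc (fun t => k i t * (c i * t + d i) * k i t) y + η • (1 : B) := by
          rw [cfc_add_const η _ y (continuousOn_finsetSum _ hs), ← cfc_sum (fun i t => k i t * (c i * t + d i) * k i t) y F hs,
            Algebra.algebraMap_eq_smul_one]
          congr 2; ext t; simp
      _ ≤ _ := by
          gcongr with i hi
          -- The two-sided form k ℓ k matters: w need not commute with y, and conjugation preserves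
          -- the order.
          rw [cfc_mul (fun t => k i t * (c i * t + d i)) (k i) y ((hk i hi).mul (by fun_prop))
            (hk i hi), cfc_mul (k i) (fun t => c i * t + d i) y (hk i hi) (by fun_prop), ← hℓ]
          exact (cfc_predicate (k i) y : IsSelfAdjoint _).conjugate_le_conjugate
            (hw _ _ (hcd i hi))

end Operator

end CStarJensen

namespace CStarJensen

/-! ### Norm continuity of the functional calculus on an interval. -/

section Spectrum

variable {B : Type*} [CStarAlgebra B] [PartialOrder B] [StarOrderedRing B]

/-- The spectrum is compact, so b₀ - c ≥ r for some r > 0, and a perturbation of norm below r/2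
costs at most half of this gap. -/
theorem eventually_smul_one_le {b₀ : B} (hb₀ : IsSelfAdjoint b₀) {c : ℝ}
    (h : ∀ s ∈ spectrum ℝ b₀, c < s) :
    ∃ ε > 0, ∀ᶠ b in 𝓝 b₀, IsSelfAdjoint b → (c + ε) • (1 : B) ≤ b := by
  rcases subsingleton_or_nontrivial B with hB | hB
  · exact ⟨1, one_pos, Eventually.of_forall fun b _ => (Subsingleton.elim _ _).le⟩
  have hsa : IsSelfAdjoint (b₀ - algebraMap ℝ B c) := hb₀.sub (.algebraMap B (.all c))
  obtain ⟨r, hr, hrb⟩ := (CFC.exists_pos_algebraMap_le_iff hsa).mpr fun s hs => by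
    rw [← spectrum.sub_singleton_eq] at hs
    obtain ⟨s', hs', _, rfl, rfl⟩ := hs
    exact sub_pos.mpr (h s' hs')
  refine ⟨r / 2, half_pos hr, ?_⟩
  filter_upwards [Metric.ball_mem_nhds b₀ (half_pos hr)] with b hb hbsa
  rw [Metric.mem_ball, dist_comm, dist_eq_norm] at hb
  have h1 : b₀ - b ≤ (r / 2) • (1 : B) := by
    rw [← Algebra.algebraMap_eq_smul_one]
    exact (hb₀.sub hbsa).le_algebraMap_norm_self.trans (algebraMap_mono B hb.le)
  rw [Algebra.algebraMap_eq_smul_one, Algebra.algebraMap_eq_smul_one, le_sub_iff_add_le,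
    ← add_smul] at hrb
  calc (c + r / 2) • (1 : B) = (r + c) • 1 - (r / 2) • 1 := by rw [← sub_smul]; congr 1; ring
    _ ≤ b₀ - (b₀ - b) := sub_le_sub hrb h1
    _ = b := sub_sub_cancel _ _

theorem eventually_le_smul_one {b₀ : B} (hb₀ : IsSelfAdjoint b₀) {c : ℝ}
    (h : ∀ s ∈ spectrum ℝ b₀, s < c) :
    ∃ ε > 0, ∀ᶠ b in 𝓝 b₀, IsSelfAdjoint b → b ≤ (c - ε) • (1 : B) := by
  obtain ⟨ε, hε, hev⟩ := eventually_smul_one_le hb₀.neg (c := -c) fun s hs => by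
    rw [← spectrum.neg_eq, Set.mem_neg] at hs
    linarith [h _ hs]
  refine ⟨ε, hε, ?_⟩
  filter_upwards [continuous_neg.continuousAt.eventually hev] with b hb hbsa
  have := hb hbsa.neg
  rw [le_neg, ← neg_smul] at this
  convert this using 2
  ring

/-- The functional calculus by a continuous function on an interval is continuous. -/
theorem continuousOn_cfc_of_ordConnected {I : Set ℝ} (hI : I.OrdConnected) {f : ℝ → ℝ}
    (hf : ContinuousOn f I) :
    ContinuousOn (cfc f) {b : B | IsSelfAdjoint b ∧ spectrum ℝ b ⊆ I} := by
  rintro b₀ ⟨hb₀, hbI⟩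
  rcases subsingleton_or_nontrivial B with hB | hB
  · exact continuousWithinAt_const.congr (fun _ _ => Subsingleton.elim _ _) (Subsingleton.elim _ 0)
  have hne : (spectrum ℝ b₀).Nonempty :=
    ContinuousFunctionalCalculus.spectrum_nonempty (R := ℝ) b₀ hb₀
  have hc := ContinuousFunctionalCalculus.isCompact_spectrum (R := ℝ) b₀
  obtain ⟨p₀, hp₀, hp₀le⟩ := hc.exists_isLeast hne
  obtain ⟨q₀, hq₀, hq₀le⟩ := hc.exists_isGreatest hne
  -- The aim is one compact interval [p, q] inside I containing the spectra of all nearby b. If I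
  -- extends to the left of the least spectral point p₀, there is room for p < p₀; otherwise p₀ is
  -- the least point of I and bounds all spectra.
  have hp : ∃ p ∈ I, ∀ᶠ b in 𝓝[{b : B | IsSelfAdjoint b ∧ spectrum ℝ b ⊆ I}] b₀,
      ∀ s ∈ spectrum ℝ b, p ≤ s := by
    by_cases h : ∃ p ∈ I, p < p₀
    · obtain ⟨p, hpI, hpp⟩ := h
      obtain ⟨ε, hε, hev⟩ := eventually_smul_one_le hb₀ (c := p)
        fun s hs => hpp.trans_le (hp₀le hs)
      refine ⟨p, hpI, ?_⟩
      filter_upwards [nhdsWithin_le_nhds hev, self_mem_nhdsWithin] with b hb hbm s hs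
      have := hb hbm.1
      rw [← Algebra.algebraMap_eq_smul_one, algebraMap_le_iff_le_spectrum (ha := hbm.1)] at this
      linarith [this s hs]
    · push Not at h
      exact ⟨p₀, hbI hp₀, by filter_upwards [self_mem_nhdsWithin] with b hb s hs using h s (hb.2 hs)⟩
  have hq : ∃ q ∈ I, ∀ᶠ b in 𝓝[{b : B | IsSelfAdjoint b ∧ spectrum ℝ b ⊆ I}] b₀,
      ∀ s ∈ spectrum ℝ b, s ≤ q := by
    by_cases h : ∃ q ∈ I, q₀ < q
    · obtain ⟨q, hqI, hqq⟩ := h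
      obtain ⟨ε, hε, hev⟩ := eventually_le_smul_one hb₀ (c := q)
        fun s hs => (hq₀le hs).trans_lt hqq
      refine ⟨q, hqI, ?_⟩
      filter_upwards [nhdsWithin_le_nhds hev, self_mem_nhdsWithin] with b hb hbm s hs
      have := hb hbm.1
      rw [← Algebra.algebraMap_eq_smul_one, le_algebraMap_iff_spectrum_le (ha := hbm.1)] at this
      linarith [this s hs]
    · push Not at h
      exact ⟨q₀, hbI hq₀, by filter_upwards [self_mem_nhdsWithin] with b hb s hs using h s (hb.2 hs)⟩
  obtain ⟨p, hpI, hp⟩ := hp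
  obtain ⟨q, hqI, hq⟩ := hq
  refine ContinuousWithinAt.cfc (s := Set.Icc p q) isCompact_Icc f ⟨hb₀, hbI⟩
    continuousWithinAt_id ?_ ?_ (hf.mono (hI.out hpI hqI))
  · filter_upwards [hp, hq] with b hbp hbq s hs using ⟨hbp s hs, hbq s hs⟩
  · filter_upwards [self_mem_nhdsWithin] with b hb using hb.1

end Spectrum

/-! ### Existence and spectrum of the column mean. -/

section ColumnMean

variable {T : Type*} [TopologicalSpace T] [T2Space T] [MeasurableSpace T] [BorelSpace T]
  {μ : Measure T} {A : Type*} [NonUnitalCStarAlgebra A]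
  {x : T → A} {a : T → 𝓜(ℂ, A)} {X : T → 𝓜(ℂ, A)}

theorem IsUnitalColumnField.integrable_conjugate [μ.Regular] (ha : IsUnitalColumnField μ a)
    (hX : Continuous X) {C : ℝ} (hC : ∀ t, ‖X t‖ ≤ C) :
    Integrable (fun t => star (a t) * X t * a t) μ := by
  have hac := ha.continuous
  refine integrable_of_continuous_of_norm_le μ (by fun_prop) ha.integrable (by fun_prop) C
    fun t => ?_
  calc _ ≤ ‖star (a t)‖ * ‖X t‖ * ‖a t‖ := norm_mul₃_le
    _ = ‖X t‖ * ‖star (a t) * a t‖ := by rw [CStarRing.norm_star_mul_self, norm_star]; ring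
    _ ≤ _ := by gcongr; exact hC t

theorem IsUnitalColumnField.integrable_sandwich [μ.Regular] (ha : IsUnitalColumnField μ a)
    (hx : Continuous x) {C : ℝ} (hC : ∀ t, ‖x t‖ ≤ C) :
    Integrable (fun t => sandwich (a t) (x t)) μ := by
  have hac := ha.continuous
  refine integrable_of_continuous_of_norm_le μ (G := fun t => star (a t) * a t) (by fun_prop)
    ha.integrable (continuous_sandwich.comp (hac.prodMk hx)) C fun t => ?_
  exact (norm_sandwich_le _ _).trans (by gcongr; exact hC t)

omit [TopologicalSpace T] [T2Space T] [BorelSpace T] in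
theorem coe_columnMean (μ : Measure T) (a : T → 𝓜(ℂ, A)) (x : T → A) :
    ((columnMean μ a x : A) : 𝓜(ℂ, A)) = ∫ t, star (a t) * (x t : 𝓜(ℂ, A)) * a t ∂μ := by
  have := (coeLI (A := A)).integral_comp_comm (μ := μ) (fun t => sandwich (a t) (x t))
  refine this.symm.trans (integral_congr_ae (Eventually.of_forall fun t => ?_))
  exact coe_sandwich _ _

omit [TopologicalSpace T] [T2Space T] [BorelSpace T] in
theorem isSelfAdjoint_columnMean (hxsa : ∀ t, IsSelfAdjoint (x t)) :
    IsSelfAdjoint (columnMean μ a x) := by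
  rw [← coe_isSelfAdjoint_iff, coe_columnMean, isSelfAdjoint_iff]
  have := (starL' ℝ : 𝓜(ℂ, A) ≃L[ℝ] 𝓜(ℂ, A)).integral_comp_comm (μ := μ)
    (fun t => star (a t) * (x t : 𝓜(ℂ, A)) * a t)
  refine this.symm.trans (integral_congr_ae (Eventually.of_forall fun t => ?_))
  simp [mul_assoc, ← coe_star, (hxsa t).star_eq]

/-- The column mean of a family with spectra in `(c, ∞)` is bounded below by some `c' > c`. -/
theorem IsUnitalColumnField.exists_smul_one_le_integral [μ.Regular] (ha : IsUnitalColumnField μ a)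
    (hX : Continuous X) (hXsa : ∀ t, IsSelfAdjoint (X t))
    (hXi : Integrable (fun t => star (a t) * X t * a t) μ)
    {c : ℝ} (hc : ∀ t, ∀ s ∈ spectrum ℝ (X t), c < s) :
    ∃ ε > 0, (c + ε) • (1 : 𝓜(ℂ, A)) ≤ ∫ t, star (a t) * X t * a t ∂μ := by
  have hac := ha.continuous
  -- The gap between sp(X t) and c need not be uniform in t. It is uniform on a compact K that
  -- carries at least half of ∫ a* a = 1; off K, the bound c ≤ X t is enough. This yields the gain
  -- ε/2.
  obtain ⟨K, hK, hKn⟩ := exists_isCompact_norm_integral_sub_lt μ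
    (G := fun t => star (a t) * a t) (by fun_prop) ha.integrable (half_pos one_pos)
  rw [ha.integral_eq_one] at hKn
  obtain ⟨ε, hε, hKε⟩ : ∃ ε > 0, ∀ t ∈ K, (c + ε) • (1 : 𝓜(ℂ, A)) ≤ X t := by
    refine hK.induction_on (p := fun S => ∃ ε > 0, ∀ t ∈ S, (c + ε) • (1 : 𝓜(ℂ, A)) ≤ X t)
      ⟨1, one_pos, by simp⟩ ?_ ?_ ?_
    · rintro S S' hS ⟨ε, hε, h⟩
      exact ⟨ε, hε, fun t ht => h t (hS ht)⟩
    · rintro S S' ⟨ε, hε, h⟩ ⟨ε', hε', h'⟩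
      refine ⟨min ε ε', lt_min hε hε', fun t ht => ?_⟩
      rcases ht with ht | ht
      · exact le_trans (smul_le_smul_of_nonneg_right (by simp) zero_le_one) (h t ht)
      · exact le_trans (smul_le_smul_of_nonneg_right (by simp) zero_le_one) (h' t ht)
    · intro t _
      obtain ⟨ε, hε, h⟩ := eventually_smul_one_le (hXsa t) (hc t)
      exact ⟨_, nhdsWithin_le_nhds (hX.continuousAt.eventually h), ε, hε, fun t ht => ht (hXsa t)⟩
  set D := ∫ t in K, star (a t) * a t ∂μ with hD
  have hD0 : 0 ≤ D := integral_nonneg fun t => star_mul_self_nonneg _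
  have hD1 : (1 / 2 : ℝ) • (1 : 𝓜(ℂ, A)) ≤ D := by
    have h1 := ((IsSelfAdjoint.one _).sub hD0.isSelfAdjoint).le_algebraMap_norm_self.trans
      (algebraMap_mono _ hKn.le)
    rw [Algebra.algebraMap_eq_smul_one, sub_le_comm] at h1
    refine le_trans (le_of_eq ?_) h1
    nth_rewrite 2 [← one_smul ℝ (1 : 𝓜(ℂ, A))]
    rw [← sub_smul]; norm_num
  have hci : Integrable (fun t => c • (star (a t) * a t)) μ := ha.integrable.smul c
  have hint : Integrable (fun t => star (a t) * X t * a t - c • (star (a t) * a t)) μ :=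
    hXi.sub hci
  have hcx : ∀ t, c • (1 : 𝓜(ℂ, A)) ≤ X t := fun t => by
    rw [← Algebra.algebraMap_eq_smul_one, algebraMap_le_iff_le_spectrum (ha := hXsa t)]
    exact fun s hs => (hc t s hs).le
  have hconj : ∀ t, star (a t) * X t * a t - c • (star (a t) * a t) =
      star (a t) * (X t - c • 1) * a t := fun t => by
    simp [mul_sub, sub_mul]
  refine ⟨ε / 2, half_pos hε, ?_⟩
  have h2 : ε • D ≤ ∫ t, (star (a t) * X t * a t - c • (star (a t) * a t)) ∂μ := by
    calc ε • D = ∫ t in K, ε • (star (a t) * a t) ∂μ := (integral_smul _ _).symm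
      _ ≤ ∫ t in K, (star (a t) * X t * a t - c • (star (a t) * a t)) ∂μ := by
          refine setIntegral_mono_on (ha.integrable.smul ε).integrableOn hint.integrableOn
            hK.measurableSet fun t ht => ?_
          have h3 := star_left_conjugate_le_conjugate (le_sub_iff_add_le'.mpr
            ((add_smul c ε (1 : 𝓜(ℂ, A))).symm.le.trans (hKε t ht))) (a t)
          rw [hconj]
          simpa using h3
      _ ≤ _ := by
          refine integral_mono_measure Measure.restrict_le_self
            (Eventually.of_forall fun t => ?_) hint
          simp only [hconj, Pi.zero_apply]
          exact star_left_conjugate_nonneg (sub_nonneg.mpr (hcx t)) _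
  rw [integral_sub hXi hci, integral_smul, ha.integral_eq_one,
    le_sub_iff_add_le'] at h2
  refine le_trans ?_ h2
  rw [add_smul, add_le_add_iff_left]
  calc (ε / 2) • (1 : 𝓜(ℂ, A)) = ε • (1 / 2 : ℝ) • 1 := by rw [smul_smul]; congr 1; ring
    _ ≤ ε • D := smul_le_smul_of_nonneg_left hD1 hε.le

/-- A point outside I lies strictly on one side of it. The strict gain in
`exists_smul_one_le_integral`, applied to X or -X, excludes it from the spectrum even when it is an
endpoint of I. -/
theorem IsUnitalColumnField.spectrum_columnMean_subset [μ.Regular] (ha : IsUnitalColumnField μ a)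
    {I : Set ℝ} (hI : I.OrdConnected) (hx : Continuous x) {C : ℝ} (hC : ∀ t, ‖x t‖ ≤ C)
    (hxsa : ∀ t, IsSelfAdjoint (x t)) (hxI : ∀ t, spectrum ℝ (x t : 𝓜(ℂ, A)) ⊆ I) :
    spectrum ℝ ((columnMean μ a x : A) : 𝓜(ℂ, A)) ⊆ I := by
  have hXc : Continuous fun t => (x t : 𝓜(ℂ, A)) := continuous_coe.comp hx
  have hXsa : ∀ t, IsSelfAdjoint (x t : 𝓜(ℂ, A)) := fun t => coe_isSelfAdjoint_iff.mpr (hxsa t)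
  have hXi := ha.integrable_conjugate hXc (C := C) fun t => (norm_coe _).trans_le (hC t)
  have hysa := coe_isSelfAdjoint_iff.mpr (isSelfAdjoint_columnMean (μ := μ) (a := a) hxsa)
  intro s hs
  by_contra hsI
  have : (∀ p ∈ I, s < p) ∨ ∀ p ∈ I, p < s := by
    by_contra! h
    obtain ⟨⟨p, hp, hps⟩, q, hq, hsq⟩ := h
    exact hsI (hI.out hp hq ⟨hps, hsq⟩)
  rcases this with h | h
  · obtain ⟨ε, hε, hle⟩ := ha.exists_smul_one_le_integral hXc hXsa hXi
      (fun t r hr => h r (hxI t hr))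
    rw [← coe_columnMean, ← Algebra.algebraMap_eq_smul_one,
      algebraMap_le_iff_le_spectrum (ha := hysa)] at hle
    linarith [hle s hs]
  · have hXi' : Integrable (fun t => star (a t) * (-(x t : 𝓜(ℂ, A))) * a t) μ := by
      simpa using! hXi.neg
    obtain ⟨ε, hε, hle⟩ := ha.exists_smul_one_le_integral (X := fun t => -(x t : 𝓜(ℂ, A)))
      hXc.neg (fun t => (hXsa t).neg) hXi'
      (c := -s) (fun t r hr => by
        rw [← spectrum.neg_eq, Set.mem_neg] at hr
        linarith [h _ (hxI t hr)])
    simp only [mul_neg, neg_mul] at hle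
    rw [integral_neg, ← coe_columnMean, le_neg, ← neg_smul, ← Algebra.algebraMap_eq_smul_one,
      le_algebraMap_iff_spectrum_le (ha := hysa)] at hle
    linarith [hle s hs]

theorem IsUnitalColumnField.integrable_cfc [μ.Regular] (ha : IsUnitalColumnField μ a)
    {I : Set ℝ} (hI : I.OrdConnected) {f : ℝ → ℝ} (hf : ContinuousOn f I)
    (hx : Continuous x) (hxb : ∃ C : ℝ, ∀ t, ‖x t‖ ≤ C)
    (hxsa : ∀ t, IsSelfAdjoint (x t)) (hxI : ∀ t, spectrum ℝ (x t : 𝓜(ℂ, A)) ⊆ I)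
    (h : IsClosed I ∨ ∃ C : ℝ, ∀ t, ‖cfc f (x t : 𝓜(ℂ, A))‖ ≤ C) :
    Integrable (fun t => star (a t) * cfc f (x t : 𝓜(ℂ, A)) * a t) μ := by
  have hb : ∃ C : ℝ, ∀ t, ‖cfc f (x t : 𝓜(ℂ, A))‖ ≤ C := by
    refine h.elim (fun hIc => ?_) id
    obtain ⟨C, hC⟩ := hxb
    -- For closed I all spectra lie in one compact subset of I, on which f is bounded. The factor
    -- ‖1‖ also covers the zero algebra.
    have hcomp : IsCompact (I ∩ Metric.closedBall 0 (C * ‖(1 : 𝓜(ℂ, A))‖)) :=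
      (isCompact_closedBall _ _).inter_left hIc
    obtain ⟨D, hD⟩ := hcomp.exists_bound_of_continuousOn (hf.mono Set.inter_subset_left)
    refine ⟨max D 0, fun t => norm_cfc_le (le_max_right _ _) fun s hs => ?_⟩
    refine (hD s ⟨hxI t hs, ?_⟩).trans (le_max_left _ _)
    rw [mem_closedBall_zero_iff]
    refine (spectrum.norm_le_norm_mul_of_mem hs).trans ?_
    rw [norm_coe]
    gcongr
    exact hC t
  obtain ⟨C, hC⟩ := hb
  refine ha.integrable_conjugate ?_ hC
  exact (continuousOn_cfc_of_ordConnected hI hf).comp_continuous (continuous_coe.comp hx)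
    fun t => ⟨coe_isSelfAdjoint_iff.mpr (hxsa t), hxI t⟩

/-- The constant d equals ∫ d a_t* a_t, so the left side is the integral of a_t* (c x_t + d) a_t,
and the integrands compare pointwise. -/
theorem IsUnitalColumnField.affine_le_integral_cfc [μ.Regular] (ha : IsUnitalColumnField μ a)
    {I : Set ℝ} {f : ℝ → ℝ} (hf : ContinuousOn f I)
    (hx : Continuous x) (hxb : ∃ C : ℝ, ∀ t, ‖x t‖ ≤ C)
    (hxsa : ∀ t, IsSelfAdjoint (x t)) (hxI : ∀ t, spectrum ℝ (x t : 𝓜(ℂ, A)) ⊆ I)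
    (hint : Integrable (fun t => star (a t) * cfc f (x t : 𝓜(ℂ, A)) * a t) μ)
    {c d : ℝ} (hcd : ∀ t ∈ I, c * t + d ≤ f t) :
    c • ((columnMean μ a x : A) : 𝓜(ℂ, A)) + d • (1 : 𝓜(ℂ, A)) ≤
      ∫ t, star (a t) * cfc f (x t : 𝓜(ℂ, A)) * a t ∂μ := by
  obtain ⟨C, hC⟩ := hxb
  have hXi : Integrable (fun t => c • (star (a t) * (x t : 𝓜(ℂ, A)) * a t)) μ :=
    (ha.integrable_conjugate (continuous_coe.comp hx) (C := C)
      fun t => (norm_coe _).trans_le (hC t)).smul c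
  have hai : Integrable (fun t => d • (star (a t) * a t)) μ := ha.integrable.smul d
  rw [coe_columnMean, ← ha.integral_eq_one, ← integral_smul, ← integral_smul,
    ← integral_add hXi hai]
  refine integral_mono (hXi.add hai) hint fun t => ?_
  have hsa : IsSelfAdjoint (x t : 𝓜(ℂ, A)) := coe_isSelfAdjoint_iff.mpr (hxsa t)
  have h1 : c • (x t : 𝓜(ℂ, A)) + d • (1 : 𝓜(ℂ, A)) ≤ cfc f (x t : 𝓜(ℂ, A)) := by
    rw [← cfc_const_mul_id c (x t : 𝓜(ℂ, A)), ← Algebra.algebraMap_eq_smul_one,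
      ← cfc_add_const d (fun s => c * s) (x t : 𝓜(ℂ, A))]
    exact cfc_mono (fun s hs => hcd s (hxI t hs)) (by fun_prop) (hf.mono (hxI t))
  simpa [mul_add, add_mul] using star_left_conjugate_le_conjugate h1 (a t)

end ColumnMean

end CStarJensen

/-! ### Positive functionals, their extension to M(A), and inequality (i). -/

namespace CStarJensen

/-- A closed real subalgebra that contains a self-adjoint element `y` contains all `g(y)`. -/
theorem cfc_mem_of_isClosed {B : Type*} [CStarAlgebra B] (S : Subalgebra ℝ B)
    (hS : IsClosed (S : Set B)) {y : B} (hy : IsSelfAdjoint y) (hyS : y ∈ S) (g : ℝ → ℝ) :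
    cfc g y ∈ S := by
  -- S need not be closed under `star`, so it is intersected with its adjoint.
  let S' : StarSubalgebra ℝ B :=
    { carrier := {u | u ∈ S ∧ star u ∈ S}
      mul_mem' := fun hu hv => ⟨mul_mem hu.1 hv.1, by rw [star_mul]; exact mul_mem hv.2 hu.2⟩
      add_mem' := fun hu hv => ⟨add_mem hu.1 hv.1, by rw [star_add]; exact add_mem hu.2 hv.2⟩
      algebraMap_mem' := fun r => ⟨S.algebraMap_mem r, by
        rw [← algebraMap_star_comm]; exact S.algebraMap_mem _⟩
      star_mem' := fun hu => ⟨hu.2, by rw [star_star]; exact hu.1⟩ }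
  have hS' : IsClosed (S' : Set B) := hS.inter (hS.preimage continuous_star)
  exact (cfc_mem (s := S') (𝕜' := ℝ) g (show y ∈ S' from ⟨hyS, by rwa [hy.star_eq]⟩)).1

section Functional

variable {A : Type*} [NonUnitalCStarAlgebra A] [PartialOrder A] [StarOrderedRing A]
  (φ : A →ₚ[ℂ] ℂ)

theorem extend_eq_of_tendsto {m : 𝓜(ℂ, A)} {z : ℂ}
    (h : Tendsto (fun e : A => φ (m.fst e)) (CStarAlgebra.approximateUnit A) (𝓝 z)) :
    extend φ m = z :=
  have := (CStarAlgebra.increasingApproximateUnit A).neBot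
  tendsto_nhds_unique (tendsto_extend φ m) h

theorem extend_add (m n : 𝓜(ℂ, A)) : extend φ (m + n) = extend φ m + extend φ n :=
  extend_eq_of_tendsto φ (by simpa using (tendsto_extend φ m).add (tendsto_extend φ n))

theorem extend_smul (c : ℂ) (m : 𝓜(ℂ, A)) : extend φ (c • m) = c * extend φ m :=
  extend_eq_of_tendsto φ (by simpa using (tendsto_extend φ m).const_mul c)

theorem exists_norm_extend_le : ∃ C : ℝ, ∀ m : 𝓜(ℂ, A), ‖extend φ m‖ ≤ C * ‖m‖ := by
  obtain ⟨C, hC⟩ := PositiveLinearMap.exists_norm_apply_le φ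
  have hl := CStarAlgebra.increasingApproximateUnit A
  have := hl.neBot
  refine ⟨C, fun m => le_of_tendsto (tendsto_extend φ m).norm ?_⟩
  filter_upwards [hl.eventually_norm] with e he
  calc _ ≤ C * ‖m.fst e‖ := hC _
    _ ≤ C * (‖m‖ * 1) := by gcongr; exact (norm_fst_apply_le m e).trans (by gcongr)
    _ = _ := by rw [mul_one]

/-- The extension of a positive functional to the multiplier algebra, as a bounded functional. -/
noncomputable def extendL : 𝓜(ℂ, A) →L[ℂ] ℂ :=
  LinearMap.mkContinuousOfExistsBound
    { toFun := extend φ, map_add' := extend_add φ, map_smul' := extend_smul φ }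
    (exists_norm_extend_le φ)

@[simp]
theorem extendL_apply (m : 𝓜(ℂ, A)) : extendL φ m = extend φ m := rfl

theorem norm_apply_star_mul_le (u v : A) :
    ‖φ (star u * v)‖ ≤ √(φ (star u * u)).re * √(φ (star v * v)).re := by
  have h := norm_inner_le_norm (𝕜 := ℂ) (φ.toPreGNS u) (φ.toPreGNS v)
  rwa [PositiveLinearMap.preGNS_inner_def, PositiveLinearMap.preGNS_norm_def,
    PositiveLinearMap.preGNS_norm_def] at h

/-- Cauchy–Schwarz applied to m d = (m √d) √d. It makes φ(m d) small once φ(d) is small, uniformly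
for bounded m. -/
theorem exists_norm_apply_fst_le : ∃ C : ℝ, 0 ≤ C ∧ ∀ (m : 𝓜(ℂ, A)) (d : A), 0 ≤ d → ‖d‖ ≤ 1 →
    ‖φ (m.fst d)‖ ≤ C * ‖m‖ * √(φ d).re := by
  obtain ⟨C, hC⟩ := PositiveLinearMap.exists_norm_apply_le φ
  refine ⟨√C, Real.sqrt_nonneg _, fun m d hd hd1 => ?_⟩
  set b := CFC.sqrt d with hb
  have hbb : b * b = d := CFC.sqrt_mul_sqrt_self d hd
  have hbs : star b = b := (CFC.sqrt_nonneg d).isSelfAdjoint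
  have hbn : ‖b‖ ^ 2 = ‖d‖ := by rw [sq, ← CStarRing.norm_star_mul_self, hbs, hbb]
  have h := norm_apply_star_mul_le φ (star (m.fst b)) b
  rw [star_star, hbs, fst_mul, hbb] at h
  refine h.trans ?_
  gcongr
  rw [← Real.sqrt_sq (norm_nonneg m), ← Real.sqrt_mul C.coe_nonneg]
  gcongr
  refine (Complex.re_le_norm _).trans ((hC _).trans ?_)
  gcongr
  rw [CStarRing.norm_self_mul_star, ← sq]
  calc ‖m.fst b‖ ^ 2 ≤ (‖m‖ * ‖b‖) ^ 2 := by gcongr; exact norm_fst_apply_le m b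
    _ = ‖m‖ ^ 2 * ‖d‖ := by rw [mul_pow, hbn]
    _ ≤ ‖m‖ ^ 2 := mul_le_of_le_one_right (by positivity) hd1

/-- The net φ(e) converges, by `tendsto_extend` at m = 1, hence varies little far out. -/
theorem exists_forall_re_apply_sub_le {ε : ℝ} (hε : 0 < ε) :
    ∃ a : A, (0 ≤ a ∧ ‖a‖ < 1) ∧ ∀ e, a ≤ e → ‖e‖ ≤ 1 → (φ (e - a)).re ≤ ε := by
  have h := tendsto_extend φ 1
  obtain ⟨a, ha, hae⟩ := ((CStarAlgebra.hasBasis_approximateUnit A).tendsto_iff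
    Metric.nhds_basis_ball).mp h (ε / 2) (half_pos hε)
  refine ⟨a, ha, fun e hae' he => ?_⟩
  have h1 := hae e ⟨hae', by simpa using he⟩
  have h2 := hae a ⟨le_rfl, by simpa using ha.2.le⟩
  simp only [DoubleCentralizer.one_fst, one_apply_eq_self, Metric.mem_ball] at h1 h2
  calc (φ (e - a)).re ≤ ‖φ e - φ a‖ := by rw [map_sub]; exact Complex.re_le_norm _
    _ = dist (φ e) (φ a) := (dist_eq_norm _ _).symm
    _ ≤ _ := dist_triangle_right _ _ (extend φ 1)
    _ ≤ ε := by linarith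

/-- The values φ(m e) need not be positive, but φ(a m a) is. Far out in the approximate unit both
φ(m a) - φ(a m a) and the distance from φ(m a) to the limit are small. -/
theorem extend_nonneg {m : 𝓜(ℂ, A)} (hm : 0 ≤ m) : 0 ≤ extend φ m := by
  obtain ⟨C, hC0, hC⟩ := exists_norm_apply_fst_le φ
  have hl := CStarAlgebra.increasingApproximateUnit A
  have hne := hl.neBot
  have hbasis := CStarAlgebra.hasBasis_approximateUnit A
  have hsub : ∀ a e : A, 0 ≤ a → a ≤ e → ‖e‖ ≤ 1 → 0 ≤ e - a ∧ ‖e - a‖ ≤ 1 := fun a e ha hae he =>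
    ⟨sub_nonneg.mpr hae, (CStarAlgebra.norm_le_norm_of_nonneg_of_le (sub_nonneg.mpr hae)
      (sub_le_self e ha)).trans he⟩
  suffices h : ∀ ε : ℝ, 0 < ε → ∃ z : ℂ, 0 ≤ z ∧ dist (extend φ m) z ≤ 2 * (C * ‖m‖) * ε by
    have hcl : IsClosed {z : ℂ | 0 ≤ z} := isClosed_Ici
    refine hcl.closure_subset (Metric.mem_closure_iff.mpr fun ε hε => ?_)
    obtain ⟨z, hz, hd⟩ := h (ε / (2 * (C * ‖m‖) + 1)) (by positivity)
    refine ⟨z, hz, hd.trans_lt ?_⟩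
    rw [mul_div_assoc', div_lt_iff₀ (by positivity)]
    nlinarith
  intro ε hε
  obtain ⟨a, ⟨ha0, ha1⟩, hae⟩ := exists_forall_re_apply_sub_le φ (ε := ε ^ 2) (by positivity)
  have hK : ∀ (n : 𝓜(ℂ, A)) (e : A), ‖n‖ ≤ ‖m‖ → a ≤ e → ‖e‖ ≤ 1 →
      ‖φ (n.fst (e - a))‖ ≤ C * ‖m‖ * ε := fun n e hn hae' he => by
    obtain ⟨h1, h2⟩ := hsub a e ha0 hae' he
    refine (hC n _ h1 h2).trans ?_
    gcongr
    exact Real.sqrt_le_iff.mpr ⟨hε.le, hae e hae' he⟩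
  have hev : ∀ᶠ e in CStarAlgebra.approximateUnit A, a ≤ e ∧ ‖e‖ ≤ 1 := by
    filter_upwards [hbasis.mem_of_mem ⟨ha0, ha1⟩] with e he
    exact ⟨he.1, by simpa using he.2⟩
  have hsa : star a = a := ha0.isSelfAdjoint
  refine ⟨φ (a * m.fst a), φ.map_nonneg (by simpa [hsa] using star_mul_fst_mul_nonneg hm a), ?_⟩
  have h1 : dist (extend φ m) (φ (m.fst a)) ≤ C * ‖m‖ * ε := by
    refine le_of_tendsto ((tendsto_extend φ m).dist tendsto_const_nhds) ?_
    filter_upwards [hev] with e he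
    rw [dist_eq_norm, ← map_sub, ← map_sub]
    exact hK m e le_rfl he.1 he.2
  have h2 : dist (φ (m.fst a)) (φ (a * m.fst a)) ≤ C * ‖m‖ * ε := by
    have hc : Continuous φ := map_continuous φ
    refine le_of_tendsto (((hc.tendsto _).comp (hl.tendsto_mul_right (m.fst a))).dist
      tendsto_const_nhds) ?_
    filter_upwards [hev] with e he
    have hes : star (e - a) = e - a := (sub_nonneg.mpr he.1).isSelfAdjoint
    -- Taking adjoints moves e - a to the right, where `hK` applies.
    have h3 : (e * m.fst a) - a * m.fst a = star ((star (m.fst a) : A) * (e - a)) := by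
      rw [star_mul, star_star, hes, sub_mul]
    rw [Function.comp_apply, dist_eq_norm, ← map_sub, h3, map_star, norm_star]
    refine hK ((star (m.fst a) : A) : 𝓜(ℂ, A)) e ?_ he.1 he.2
    rw [norm_coe, norm_star]
    exact (norm_fst_apply_le m a).trans (mul_le_of_le_one_right (norm_nonneg _) ha1.le)
  linarith [dist_triangle (extend φ m) (φ (m.fst a)) (φ (a * m.fst a))]

theorem extend_mono {m n : 𝓜(ℂ, A)} (h : m ≤ n) : extend φ m ≤ extend φ n := by
  have := extend_nonneg φ (sub_nonneg.mpr h)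
  simp only [← extendL_apply, map_sub] at this ⊢
  exact sub_nonneg.mp this

variable {φ}

/-- The hypothesis concerns elements of A only, so m is replaced by m e and e runs through the
approximate unit; m y and y m already lie in A. -/
theorem InCentralizer.extend_mul_comm {y : A} (hy : InCentralizer φ y) (m : 𝓜(ℂ, A)) :
    extend φ (m * y) = extend φ (y * m) := by
  have hl := CStarAlgebra.increasingApproximateUnit A
  have := hl.neBot
  have hc : Continuous φ := map_continuous φ
  rw [← coe_fst, ← coe_snd, extend_coe, extend_coe]
  have h1 : Tendsto (fun e : A => φ (m.fst (e * y))) (CStarAlgebra.approximateUnit A)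
      (𝓝 (φ (m.fst y))) :=
    ((hc.comp m.fst.continuous).tendsto _).comp (hl.tendsto_mul_right y)
  have h2 : Tendsto (fun e : A => φ (m.snd y * e)) (CStarAlgebra.approximateUnit A)
      (𝓝 (φ (m.snd y))) :=
    (hc.tendsto _).comp (hl.tendsto_mul_left (m.snd y))
  refine tendsto_nhds_unique h1 (h2.congr fun e => ?_)
  rw [m.central, ← hy, fst_mul]

/-- The centralizer of a bounded functional is a norm closed algebra. -/
theorem InCentralizer.extend_mul_cfc_comm {y : A} (hy : InCentralizer φ y) (hysa : IsSelfAdjoint y)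
    (m : 𝓜(ℂ, A)) (g : ℝ → ℝ) :
    extend φ (m * cfc g (y : 𝓜(ℂ, A))) = extend φ (cfc g (y : 𝓜(ℂ, A)) * m) := by
  let S : Subalgebra ℝ 𝓜(ℂ, A) :=
    { carrier := {u | ∀ m : 𝓜(ℂ, A), extendL φ (m * u) = extendL φ (u * m)}
      mul_mem' := fun {u v} hu hv m => by rw [← mul_assoc, hv, ← mul_assoc, hu, mul_assoc]
      add_mem' := fun {u v} hu hv m => by rw [mul_add, add_mul, map_add, map_add, hu, hv]
      algebraMap_mem' := fun r m => by rw [Algebra.commutes] }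
  have hS : IsClosed (S : Set 𝓜(ℂ, A)) := by
    have : (S : Set 𝓜(ℂ, A)) = ⋂ m : 𝓜(ℂ, A), {u | extendL φ (m * u) = extendL φ (u * m)} := by
      ext u; simp [S]
    rw [this]
    exact isClosed_iInter fun m => isClosed_eq (by fun_prop) (by fun_prop)
  exact cfc_mem_of_isClosed S hS (coe_isSelfAdjoint_iff.mpr hysa) (hy.extend_mul_comm) g m

/-- Jensen's inequality for a positive functional with `y` in its centralizer. -/
theorem InCentralizer.extend_cfc_le {y : A} (hy : InCentralizer φ y) (hysa : IsSelfAdjoint y)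
    {I : Set ℝ} {f : ℝ → ℝ} (hf : ContinuousOn f I)
    (hfc : ConvexOn ℝ I f) {w : 𝓜(ℂ, A)} (hyI : spectrum ℝ (y : 𝓜(ℂ, A)) ⊆ I)
    (hw : ∀ c d : ℝ, (∀ t ∈ I, c * t + d ≤ f t) →
      c • (y : 𝓜(ℂ, A)) + d • (1 : 𝓜(ℂ, A)) ≤ w) :
    extend φ (cfc f (y : 𝓜(ℂ, A))) ≤ extend φ w := by
  have hysa' : IsSelfAdjoint (y : 𝓜(ℂ, A)) := coe_isSelfAdjoint_iff.mpr hysa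
  have key : ∀ η : ℝ, 0 < η →
      extend φ (cfc f (y : 𝓜(ℂ, A))) ≤ extend φ w + η * extend φ 1 := by
    intro η hη
    obtain ⟨F, k, -, hk1, hle⟩ := exists_cfc_le_sum hf hfc hysa' hyI hw hη
    refine (extend_mono φ hle).trans (le_of_eq ?_)
    have h1 : extend φ (∑ i ∈ F, cfc (k i) (y : 𝓜(ℂ, A)) * w * cfc (k i) (y : 𝓜(ℂ, A))) =
        extend φ w := by
      calc _ = ∑ i ∈ F, extend φ (cfc (k i) (y : 𝓜(ℂ, A)) * w * cfc (k i) (y : 𝓜(ℂ, A))) :=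
            map_sum (extendL φ) _ F
        _ = ∑ i ∈ F, extend φ (w * (cfc (k i) (y : 𝓜(ℂ, A)) * cfc (k i) (y : 𝓜(ℂ, A)))) :=
            Finset.sum_congr rfl fun i _ => by
              rw [mul_assoc, ← hy.extend_mul_cfc_comm hysa, mul_assoc]
        _ = extend φ (∑ i ∈ F, w * (cfc (k i) (y : 𝓜(ℂ, A)) * cfc (k i) (y : 𝓜(ℂ, A)))) :=
            (map_sum (extendL φ) _ F).symm
        _ = _ := by rw [← Finset.mul_sum, hk1, mul_one]
    rw [extend_add, h1]
    congr 1
    exact extend_smul φ (η : ℂ) 1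
  have ht : Tendsto (fun η : ℝ => extend φ w + η * extend φ 1) (𝓝[>] 0) (𝓝 (extend φ w)) := by
    have : Continuous (fun η : ℝ => extend φ w + η * extend φ 1) := by fun_prop
    simpa using (this.tendsto 0).mono_left nhdsWithin_le_nhds
  exact ge_of_tendsto ht (eventually_mem_nhdsWithin.mono fun η hη => key η hη)

end Functional

end CStarJensen

namespace CStarJensen

/-! ### The minimal dense ideal as an ideal of M(A). -/

section PedersenIdeal

variable {A : Type*} [NonUnitalCStarAlgebra A] [PartialOrder A] [StarOrderedRing A]

variable (A) in
/-- The positive elements that possess a positive local unit. -/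
def localUnitSet : Set A := {z : A | 0 ≤ z ∧ ∃ e : A, 0 ≤ e ∧ z = z * e}

variable (A) in
/-- The positive part of the minimal dense ideal. -/
def pedersenCone : Set A := {x : A | 0 ≤ x ∧ ∃ s ∈ AddSubmonoid.closure (localUnitSet A), x ≤ s}

omit [StarOrderedRing A] in
theorem pedersenCone_subset {x : A} (hx : x ∈ pedersenCone A) : x ∈ pedersenIdeal A :=
  Submodule.subset_span hx

theorem nonneg_of_mem_closure {s : A} (hs : s ∈ AddSubmonoid.closure (localUnitSet A)) : 0 ≤ s := by
  induction hs using AddSubmonoid.closure_induction with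
  | mem x hx => exact hx.1
  | zero => exact le_rfl
  | add x y _ _ hx hy => exact add_nonneg hx hy

theorem mem_pedersenCone_of_mem_closure {s : A}
    (hs : s ∈ AddSubmonoid.closure (localUnitSet A)) : s ∈ pedersenCone A :=
  ⟨nonneg_of_mem_closure hs, s, hs, le_rfl⟩

omit [StarOrderedRing A] in
theorem mem_pedersenCone_of_le {x y : A} (hx : 0 ≤ x) (hxy : x ≤ y) (hy : y ∈ pedersenCone A) :
    x ∈ pedersenCone A := by
  obtain ⟨-, s, hs, hys⟩ := hy
  exact ⟨hx, s, hs, hxy.trans hys⟩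

theorem zero_mem_pedersenCone : (0 : A) ∈ pedersenCone A :=
  mem_pedersenCone_of_mem_closure (zero_mem _)

theorem add_mem_pedersenCone {x y : A} (hx : x ∈ pedersenCone A) (hy : y ∈ pedersenCone A) :
    x + y ∈ pedersenCone A := by
  obtain ⟨hx0, s, hs, hxs⟩ := hx
  obtain ⟨hy0, t, ht, hyt⟩ := hy
  exact ⟨add_nonneg hx0 hy0, s + t, add_mem hs ht, add_le_add hxs hyt⟩

theorem map_mem_pedersenCone (F : A →+ A) (hF : ∀ x, 0 ≤ x → 0 ≤ F x)
    (hFl : ∀ z ∈ localUnitSet A, F z ∈ localUnitSet A) {x : A} (hx : x ∈ pedersenCone A) :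
    F x ∈ pedersenCone A := by
  obtain ⟨hx0, s, hs, hxs⟩ := hx
  refine ⟨hF x hx0, F s, ?_, ?_⟩
  · have := AddSubmonoid.mem_map_of_mem F hs
    rw [AddMonoidHom.map_mclosure] at this
    refine AddSubmonoid.closure_mono ?_ this
    rintro _ ⟨z, hz, rfl⟩
    exact hFl z hz
  · rw [← sub_nonneg, ← map_sub]
    exact hF _ (sub_nonneg.mpr hxs)

theorem smul_mem_pedersenCone {c : ℝ} (hc : 0 ≤ c) {x : A} (hx : x ∈ pedersenCone A) :
    c • x ∈ pedersenCone A :=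
  map_mem_pedersenCone (DistribSMul.toAddMonoidHom A c) (fun _ h => smul_nonneg hc h)
    (fun z ⟨hz, e, he, hze⟩ => ⟨smul_nonneg hc hz, e, he, by
      simp only [DistribSMul.toAddMonoidHom_apply, smul_mul_assoc, ← hze]⟩) hx

theorem sandwich_add_left_le (u v : 𝓜(ℂ, A)) {x : A} (hx : 0 ≤ x) :
    sandwich (u + v) x ≤ (2 : ℝ) • sandwich u x + (2 : ℝ) • sandwich v x := by
  rw [← sandwich_add_left_add_sandwich_sub_left]
  exact le_add_of_nonneg_right (sandwich_nonneg _ hx)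

/-- A unitary u carries z = z e to u* z u = (u* z u)(u* e u). Every multiplier is a combination of
unitaries, and (u+v)* x (u+v) ≤ 2 u* x u + 2 v* x v together with heredity of the cone handles sums.
-/
theorem sandwich_mem_pedersenCone (u : 𝓜(ℂ, A)) {x : A} (hx : x ∈ pedersenCone A) :
    sandwich u x ∈ pedersenCone A := by
  have hu : u ∈ Submodule.span ℂ (unitary 𝓜(ℂ, A) : Set 𝓜(ℂ, A)) := by
    rw [CStarAlgebra.span_unitary]; trivial
  induction hu using Submodule.span_induction with
  | mem u hu =>
    refine map_mem_pedersenCone ⟨⟨sandwich u, sandwich_zero u⟩, sandwich_add u⟩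
      (fun _ h => sandwich_nonneg u h) ?_ hx
    rintro z ⟨hz, e, he, hze⟩
    refine ⟨sandwich_nonneg u hz, sandwich u e, sandwich_nonneg u he, ?_⟩
    apply coe_injective
    simp only [ZeroHom.coe_mk, AddMonoidHom.coe_mk, coe_mul, coe_sandwich]
    have h1 : u * star u = 1 := Unitary.mul_star_self_of_mem hu
    have h2 : (z : 𝓜(ℂ, A)) = z * e := by rw [← coe_mul, ← hze]
    calc star u * (z : 𝓜(ℂ, A)) * u = star u * (z * 1 * e) * u := by rw [mul_one, ← h2]
      _ = _ := by rw [← h1]; noncomm_ring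
  | zero => simpa [sandwich] using zero_mem_pedersenCone
  | add u v _ _ hu hv =>
    exact mem_pedersenCone_of_le (sandwich_nonneg _ hx.1) (sandwich_add_left_le u v hx.1)
      (add_mem_pedersenCone (smul_mem_pedersenCone zero_le_two hu)
        (smul_mem_pedersenCone zero_le_two hv))
  | smul c u _ hu =>
    rw [sandwich_smul]
    exact smul_mem_pedersenCone (by positivity) hu

/-- Every positive element is approximated by smaller elements of the minimal dense ideal. -/
theorem exists_mem_pedersenCone_near {x : A} (hx : 0 ≤ x) {η : ℝ} (hη : 0 < η) :
    ∃ z ∈ pedersenCone A, z ≤ x ∧ ‖z - x‖ ≤ η := by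
  have hsa := hx.isSelfAdjoint
  have hσ : ∀ t ∈ quasispectrum ℝ x, 0 ≤ t := fun t ht => quasispectrum_nonneg_of_nonneg x hx t ht
  have hid : cfcₙ (fun t : ℝ => t) x = x := cfcₙ_id' ℝ x
  have hz0 : max (0 - η) 0 = 0 := by simp [hη.le]
  have hz : 0 ≤ cfcₙ (fun t : ℝ => max (t - η) 0) x := cfcₙ_nonneg fun t _ => le_max_right _ _
  have he : 0 ≤ cfcₙ (fun t : ℝ => min (t / η) 1) x :=
    cfcₙ_nonneg fun t ht => le_min (div_nonneg (hσ t ht) hη.le) zero_le_one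
  -- The approximant is (x - η)₊; its local unit min(x/η, 1) equals 1 wherever t ≥ η.
  refine ⟨cfcₙ (fun t : ℝ => max (t - η) 0) x, ?_, ?_, ?_⟩
  · refine mem_pedersenCone_of_mem_closure (AddSubmonoid.subset_closure ⟨hz, _, he, ?_⟩)
    rw [← cfcₙ_mul (fun t : ℝ => max (t - η) 0) (fun t : ℝ => min (t / η) 1) x (by fun_prop) hz0 (by fun_prop) (by simp)]
    refine cfcₙ_congr fun t ht => ?_
    rcases le_total t η with h | h
    · simp [max_eq_right (sub_nonpos.mpr h)]
    · simp [min_eq_right ((one_le_div hη).mpr h)]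
  · nth_rewrite 2 [← hid]
    exact cfcₙ_mono (fun t ht => max_le (by linarith) (hσ t ht)) (by fun_prop) (by fun_prop) hz0 rfl
  · nth_rewrite 2 [← hid]
    rw [← cfcₙ_sub (fun t : ℝ => max (t - η) 0) (fun t : ℝ => t) x (by fun_prop) hz0 (by fun_prop) rfl]
    refine norm_cfcₙ_le fun t ht => ?_
    rw [Real.norm_eq_abs, abs_le]
    have := hσ t ht
    rcases le_total t η with h | h
    · rw [max_eq_right (sub_nonpos.mpr h)]; constructor <;> linarith
    · rw [max_eq_left (sub_nonneg.mpr h)]; constructor <;> linarith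

theorem fst_snd_mem_pedersenIdeal (v w : 𝓜(ℂ, A)) {x : A} (hx : x ∈ pedersenIdeal A) :
    v.fst (w.snd x) ∈ pedersenIdeal A := by
  induction hx using Submodule.span_induction with
  | mem x hx =>
    have := fun u => pedersenCone_subset (sandwich_mem_pedersenCone u hx)
    rw [← star_star v, polarization_sandwich]
    exact Submodule.smul_mem _ _ (add_mem (sub_mem (sub_mem (this _) (this _))
      (Submodule.smul_mem _ _ (this _))) (Submodule.smul_mem _ _ (this _)))
  | zero => simp
  | add x y _ _ hx hy => simpa using add_mem hx hy
  | smul c x _ hx => simpa using Submodule.smul_mem _ c hx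

theorem fst_mem_pedersenIdeal (v : 𝓜(ℂ, A)) {x : A} (hx : x ∈ pedersenIdeal A) :
    v.fst x ∈ pedersenIdeal A := by simpa using fst_snd_mem_pedersenIdeal v 1 hx

theorem snd_mem_pedersenIdeal (v : 𝓜(ℂ, A)) {x : A} (hx : x ∈ pedersenIdeal A) :
    v.snd x ∈ pedersenIdeal A := by simpa using fst_snd_mem_pedersenIdeal 1 v hx

variable (A) in
/-- The self-adjoint elements `z` such that `z` and `-z` are dominated by an element of the minimal
dense ideal. -/
def dominatedSubmodule : Submodule ℝ A where
  carrier := {z | IsSelfAdjoint z ∧ ∃ s ∈ pedersenCone A, z ≤ s ∧ -z ≤ s}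
  zero_mem' := ⟨.zero A, 0, zero_mem_pedersenCone, le_rfl, by simp⟩
  add_mem' := by
    rintro z z' ⟨hz, s, hs, h1, h2⟩ ⟨hz', s', hs', h1', h2'⟩
    refine ⟨hz.add hz', s + s', add_mem_pedersenCone hs hs', add_le_add h1 h1', ?_⟩
    rw [neg_add]
    exact add_le_add h2 h2'
  smul_mem' := by
    rintro c z ⟨hz, s, hs, h1, h2⟩
    refine ⟨(IsSelfAdjoint.all c).smul hz, |c| • s, smul_mem_pedersenCone (abs_nonneg c) hs, ?_⟩
    rcases le_total 0 c with h | h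
    · rw [abs_of_nonneg h, ← smul_neg]
      exact ⟨smul_le_smul_of_nonneg_left h1 h, smul_le_smul_of_nonneg_left h2 h⟩
    · rw [abs_of_nonpos h, ← neg_smul, ← neg_neg c, neg_smul (-c) z, ← smul_neg, neg_neg]
      exact ⟨smul_le_smul_of_nonneg_left h2 (neg_nonneg.mpr h),
        smul_le_smul_of_nonneg_left h1 (neg_nonneg.mpr h)⟩

/-- Domination by the cone is all that the finiteness of a weight at the four positive parts of z
will require. -/
theorem mem_dominatedSubmodule_of_mem {z : A} (hz : z ∈ pedersenIdeal A) :
    (ℜ z : A) ∈ dominatedSubmodule A ∧ (ℑ z : A) ∈ dominatedSubmodule A := by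
  induction hz using Submodule.span_induction with
  | mem x hx =>
    have hsa : IsSelfAdjoint x := hx.1.isSelfAdjoint
    rw [hsa.coe_realPart, hsa.imaginaryPart]
    refine ⟨⟨hsa, x, hx, le_rfl, ?_⟩, zero_mem _⟩
    exact (neg_nonpos.mpr hx.1).trans hx.1
  | zero => simp
  | add x y _ _ hx hy =>
    simp only [map_add, AddSubgroup.coe_add]
    exact ⟨add_mem hx.1 hy.1, add_mem hx.2 hy.2⟩
  | smul c x _ hx =>
    simp only [realPart_smul, imaginaryPart_smul, AddSubgroupClass.coe_sub, AddSubgroup.coe_add,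
      selfAdjoint.val_smul]
    exact ⟨sub_mem (Submodule.smul_mem _ _ hx.1) (Submodule.smul_mem _ _ hx.2),
      add_mem (Submodule.smul_mem _ _ hx.2) (Submodule.smul_mem _ _ hx.1)⟩

end PedersenIdeal

end CStarJensen

namespace CStarJensen

/-! ### Finiteness and linearity of the extension of a weight. -/

namespace Weight

variable {A : Type*} [NonUnitalCStarAlgebra A] [PartialOrder A] [StarOrderedRing A]

/-- The value of a weight at the positive part of an element. -/
noncomputable def val (φ : Weight A) (x : A) : ℝ≥0∞ := φ.toFun ⟨x⁺, CFC.posPart_nonneg x⟩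

variable (φ : Weight A)

theorem val_of_nonneg {x : A} (hx : 0 ≤ x) : φ.val x = φ.toFun ⟨x, hx⟩ := by
  rw [val]
  congr 1
  exact Subtype.ext (CFC.posPart_eq_self x |>.mpr hx)

theorem val_posPart (x : A) : φ.val x⁺ = φ.val x := φ.val_of_nonneg (CFC.posPart_nonneg x)

theorem val_negPart (x : A) : φ.val x⁻ = φ.val (-x) := by
  rw [← CFC.posPart_neg, val_posPart]

theorem val_add {x y : A} (hx : 0 ≤ x) (hy : 0 ≤ y) : φ.val (x + y) = φ.val x + φ.val y := by
  rw [φ.val_of_nonneg hx, φ.val_of_nonneg hy, φ.val_of_nonneg (add_nonneg hx hy), ← φ.map_add]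
  rfl

theorem val_smul {c : ℝ} (hc : 0 ≤ c) {x : A} (hx : 0 ≤ x) :
    φ.val (c • x) = ENNReal.ofReal c * φ.val x := by
  rw [φ.val_of_nonneg hx, φ.val_of_nonneg (smul_nonneg hc hx)]
  exact (φ.map_smul ⟨c, hc⟩ ⟨x, hx⟩).trans (by rw [ENNReal.ofReal_eq_coe_nnreal hc]; rfl)

theorem val_zero : φ.val 0 = 0 := by
  have := φ.val_smul (le_refl (0 : ℝ)) (le_refl (0 : A))
  simpa using this

theorem val_mono {x y : A} (hx : 0 ≤ x) (h : x ≤ y) : φ.val x ≤ φ.val y := by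
  rw [← add_sub_cancel x y, φ.val_add hx (sub_nonneg.mpr h)]
  exact le_self_add

theorem linearExtension_eq (z : A) : φ.linearExtension z =
    (((φ.val (ℜ z)).toReal - (φ.val (-(ℜ z : A))).toReal : ℝ) : ℂ) +
      (((φ.val (ℑ z)).toReal - (φ.val (-(ℑ z : A))).toReal : ℝ) : ℂ) * Complex.I := by
  rw [← val_negPart, ← val_negPart, φ.val_of_nonneg (CFC.negPart_nonneg _),
    φ.val_of_nonneg (CFC.negPart_nonneg _)]
  rfl

theorem linearExtension_of_nonneg {x : A} (hx : 0 ≤ x) :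
    φ.linearExtension x = ((φ.val x).toReal : ℂ) := by
  have h1 : φ.val (-x) = 0 := by
    rw [← val_negPart, (CFC.negPart_eq_zero_iff x).mpr hx, val_zero]
  rw [linearExtension_eq, hx.isSelfAdjoint.coe_realPart, hx.isSelfAdjoint.imaginaryPart, h1]
  simp [val_zero]

variable {φ}

theorem val_le_of_eventually (hφ : LowerSemicontinuous φ.toFun) {ι : Type*} {l : Filter ι} [l.NeBot]
    {u : ι → A} {x : A} (hu0 : ∀ i, 0 ≤ u i) (hu : Tendsto u l (𝓝 x)) {M : ℝ≥0∞}
    (hM : ∀ᶠ i in l, φ.val (u i) ≤ M) : φ.val x ≤ M := by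
  have hx : 0 ≤ x := ge_of_tendsto hu (Eventually.of_forall hu0)
  by_contra! h
  rw [φ.val_of_nonneg hx] at h
  have ht : Tendsto (fun i => (⟨u i, hu0 i⟩ : {x : A // 0 ≤ x})) l (𝓝 ⟨x, hx⟩) :=
    tendsto_subtype_rng.mpr hu
  obtain ⟨i, hi, hi'⟩ := ((ht.eventually (hφ ⟨x, hx⟩ M h)).and hM).exists
  rw [← φ.val_of_nonneg (hu0 i)] at hi
  exact hi.not_ge hi'

theorem val_le_of_tendsto (hφ : LowerSemicontinuous φ.toFun) {ι : Type*} {l : Filter ι} [l.NeBot]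
    {u : ι → A} {x : A} (hu0 : ∀ i, 0 ≤ u i) (hu : Tendsto u l (𝓝 x)) {M : ℝ≥0∞}
    (hM : ∀ i, φ.val (u i) ≤ M) : φ.val x ≤ M :=
  val_le_of_eventually hφ hu0 hu (Eventually.of_forall hM)

theorem FiniteOnPedersenIdeal.val_lt_top (hK : φ.FiniteOnPedersenIdeal) {x : A}
    (hx : x ∈ pedersenCone A) : φ.val x < ∞ := by
  rw [φ.val_of_nonneg hx.1]
  exact hK ⟨x, hx.1⟩ (pedersenCone_subset hx)

theorem val_sandwich_add_le (u v : 𝓜(ℂ, A)) {s : A} (hs : 0 ≤ s) :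
    φ.val (sandwich (u + v) s) ≤ 2 * φ.val (sandwich u s) + 2 * φ.val (sandwich v s) := by
  have hu := sandwich_nonneg u hs
  have hv := sandwich_nonneg v hs
  refine (φ.val_mono (sandwich_nonneg _ hs) (sandwich_add_left_le u v hs)).trans_eq ?_
  rw [φ.val_add (smul_nonneg zero_le_two hu) (smul_nonneg zero_le_two hv),
    φ.val_smul zero_le_two hu, φ.val_smul zero_le_two hv]
  simp

/-- A lower semicontinuous weight that is finite on the minimal dense ideal is bounded on the
elements `u* s u` with `‖u‖ ≤ 1`, for every `s` in the minimal dense ideal. -/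
theorem FiniteOnPedersenIdeal.exists_val_sandwich_le (hK : φ.FiniteOnPedersenIdeal)
    (hφ : LowerSemicontinuous φ.toFun) {s : A} (hs : s ∈ pedersenCone A) :
    ∃ M : ℝ≥0, ∀ u : 𝓜(ℂ, A), ‖u‖ ≤ 1 → φ.val (sandwich u s) ≤ M := by
  have hcont : Continuous fun u : 𝓜(ℂ, A) =>
      (⟨sandwich u s, sandwich_nonneg u hs.1⟩ : {x : A // 0 ≤ x}) :=
    Continuous.subtype_mk (continuous_sandwich.comp (by fun_prop : Continuous fun u => (u, s))) _
  have hcl : ∀ n : ℕ, IsClosed {u : 𝓜(ℂ, A) | φ.val (sandwich u s) ≤ n} := fun n => by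
    have := (hφ.isClosed_preimage (n : ℝ≥0∞)).preimage hcont
    convert this using 1
    ext u
    simp [φ.val_of_nonneg (sandwich_nonneg u hs.1)]
  have hun : ⋃ n : ℕ, {u : 𝓜(ℂ, A) | φ.val (sandwich u s) ≤ n} = Set.univ := by
    refine Set.eq_univ_of_forall fun u => ?_
    obtain ⟨n, hn⟩ := ENNReal.exists_nat_gt (hK.val_lt_top (sandwich_mem_pedersenCone u hs)).ne
    exact Set.mem_iUnion.mpr ⟨n, hn.le⟩
  -- Baire: some closed sublevel set contains a ball around u₀. Then v = (u₀ + v) - u₀ gives the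
  -- bound 2n + 2n for small v, and scaling by r/2 reaches the unit ball.
  obtain ⟨n, u₀, hu₀⟩ := nonempty_interior_of_iUnion_of_closed hcl hun
  obtain ⟨r, hr, hball⟩ := Metric.isOpen_iff.mp isOpen_interior u₀ hu₀
  have hball := hball.trans interior_subset
  refine ⟨((r / 2) ^ 2)⁻¹.toNNReal * (4 * n), fun u hu => ?_⟩
  set v : 𝓜(ℂ, A) := ((r / 2 : ℝ) : ℂ) • u with hv
  have hvn : ‖v‖ < r := by
    rw [hv, norm_smul, Complex.norm_real, Real.norm_of_nonneg (by positivity)]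
    nlinarith [norm_nonneg u]
  have h1 : φ.val (sandwich (u₀ + v) s) ≤ n := hball (by simpa using hvn)
  have h2 : φ.val (sandwich (-u₀) s) ≤ n := by
    have : sandwich (-u₀) s = sandwich u₀ s := by simp [sandwich]
    rw [this]
    exact hball (by simpa using hr)
  have h3 : φ.val (sandwich v s) ≤ 4 * n := by
    have := val_sandwich_add_le (φ := φ) (u₀ + v) (-u₀) hs.1
    rw [add_neg_cancel_comm] at this
    calc _ ≤ _ := this
      _ ≤ 2 * n + 2 * n := by gcongr
      _ = 4 * n := by ring
  have h4 : sandwich u s = ((r / 2) ^ 2)⁻¹ • sandwich v s := by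
    rw [hv, sandwich_smul, Complex.norm_real, Real.norm_of_nonneg (by positivity),
      inv_smul_smul₀ (by positivity)]
  rw [h4, φ.val_smul (by positivity) (sandwich_nonneg v hs.1)]
  push_cast
  rw [ENNReal.ofReal]
  gcongr

/-- In a noncommutative algebra z ≤ s does not give z⁺ ≤ s. Instead g_n(z) z g_n(z) tends to z⁺ and
lies below g_n(z) s g_n(z), whose weight is bounded uniformly in n; lower semicontinuity concludes.
-/
theorem FiniteOnPedersenIdeal.val_lt_top_of_le (hK : φ.FiniteOnPedersenIdeal)
    (hφ : LowerSemicontinuous φ.toFun) {s z : A} (hs : s ∈ pedersenCone A) (hz : IsSelfAdjoint z)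
    (hzs : z ≤ s) : φ.val z < ∞ := by
  obtain ⟨M, hM⟩ := hK.exists_val_sandwich_le hφ hs
  have hid : cfcₙ (fun t : ℝ => t) z = z := cfcₙ_id' ℝ z
  -- g_n kills the negative part, and g_n(t)² t differs from t⁺ only for 0 < t < 1/(n+1), hence by
  -- at most 1/(n+1).
  set g : ℕ → ℝ → ℝ := fun n t => min 1 ((n + 1) * max t 0) with hg
  have hgc : ∀ n, Continuous (g n) := fun n => by fun_prop
  have hg0 : ∀ n, g n 0 = 0 := fun n => by simp [hg]
  have hg1 : ∀ n t, 0 ≤ g n t ∧ g n t ≤ 1 := fun n t => ⟨by positivity, min_le_left _ _⟩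
  have hcomp : ∀ n, sandwich ((cfcₙ (g n) z : A) : 𝓜(ℂ, A)) z =
      cfcₙ (fun t => g n t * t * g n t) z := fun n => by
    rw [cfcₙ_mul (fun t => g n t * t) (g n) z (by fun_prop) (by simp) (by fun_prop) (hg0 n),
      cfcₙ_mul (g n) (fun t => t) z (by fun_prop) (hg0 n) (by fun_prop) rfl, hid]
    refine coe_injective ?_
    dsimp only
    rw [coe_sandwich, coe_mul, coe_mul, ← coe_star,
      (cfcₙ_predicate (g n) z : IsSelfAdjoint _).star_eq]
  have hpos : ∀ n t, 0 ≤ g n t * t * g n t := fun n t => by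
    rcases le_total 0 t with h | h
    · have := (hg1 n t).1; positivity
    · simp [hg, max_eq_right h]
  rw [← val_posPart]
  refine (val_le_of_tendsto hφ (l := atTop) (M := M)
    (u := fun n => sandwich ((cfcₙ (g n) z : A) : 𝓜(ℂ, A)) z) (fun n => ?_) ?_
    fun n => ?_).trans_lt ENNReal.coe_lt_top
  · rw [hcomp]
    exact cfcₙ_nonneg fun t _ => hpos n t
  · rw [tendsto_iff_norm_sub_tendsto_zero]
    refine squeeze_zero (fun _ => norm_nonneg _) (fun n => ?_) tendsto_one_div_add_atTop_nhds_zero_nat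
    rw [hcomp, CFC.posPart_def, ← cfcₙ_sub (fun t => g n t * t * g n t) (fun t => t⁺) z
      (by fun_prop) (by simp) (by fun_prop) (by simp)]
    refine norm_cfcₙ_le fun t _ => ?_
    have hn : (0 : ℝ) < n + 1 := by positivity
    rw [Real.norm_eq_abs, abs_le]
    rcases le_total t 0 with h | h
    · simp only [hg, max_eq_right h, posPart_eq_zero.mpr h]
      norm_num
      positivity
    · rw [posPart_eq_self.mpr h]
      rcases le_total 1 ((n + 1) * t) with h' | h'
      · simp only [hg, max_eq_left h, min_eq_left h']
        norm_num
        positivity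
      · have ht : t ≤ 1 / (n + 1) := by rw [le_div_iff₀ hn]; linarith
        have h1 := hg1 n t
        have h2 : g n t * t * g n t ≤ t := by nlinarith [mul_nonneg h1.1 h, h1.2]
        have := hpos n t
        constructor <;> linarith
  · refine (φ.val_mono ?_ (sandwich_mono _ hzs)).trans (hM _ ?_)
    · rw [hcomp]
      exact cfcₙ_nonneg fun t _ => hpos n t
    · rw [norm_coe]
      refine norm_cfcₙ_le fun t _ => ?_
      rw [Real.norm_of_nonneg (hg1 n t).1]
      exact (hg1 n t).2

theorem FiniteOnPedersenIdeal.val_ne_top_of_mem (hK : φ.FiniteOnPedersenIdeal)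
    (hφ : LowerSemicontinuous φ.toFun) {z : A} (hz : z ∈ dominatedSubmodule A) :
    φ.val z ≠ ∞ := by
  obtain ⟨hsa, s, hs, h, -⟩ := hz
  exact (hK.val_lt_top_of_le hφ hs hsa h).ne

/-- From z⁺ + q = p + z⁻: the difference of values does not depend on the decomposition of z, which
is the source of additivity. -/
theorem val_toReal_sub_val_toReal {z p q : A} (hz : IsSelfAdjoint z)
    (h1 : φ.val z ≠ ∞) (h2 : φ.val (-z) ≠ ∞) (hp : 0 ≤ p) (hq : 0 ≤ q) (hpt : φ.val p ≠ ∞)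
    (hqt : φ.val q ≠ ∞) (hzpq : z = p - q) :
    (φ.val z).toReal - (φ.val (-z)).toReal = (φ.val p).toReal - (φ.val q).toReal := by
  have h : z⁺ + q = p + z⁻ := by
    have := CFC.posPart_sub_negPart z hz
    rw [← sub_eq_sub_iff_add_eq_add, this, hzpq]
  have h' := congrArg φ.val h
  rw [φ.val_add (CFC.posPart_nonneg z) hq, φ.val_add hp (CFC.negPart_nonneg z), val_posPart,
    val_negPart] at h'
  have h3 := congrArg ENNReal.toReal h'
  rw [ENNReal.toReal_add h1 hqt, ENNReal.toReal_add hpt h2] at h3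
  linarith

/-- The real linear functional determined by a weight on the self-adjoint part of the minimal dense
ideal. -/
noncomputable def realExtension (hK : φ.FiniteOnPedersenIdeal)
    (hφ : LowerSemicontinuous φ.toFun) : dominatedSubmodule A →ₗ[ℝ] ℝ where
  toFun z := (φ.val (z : A)).toReal - (φ.val (-(z : A))).toReal
  map_add' z z' := by
    have hf : ∀ z ∈ dominatedSubmodule A, φ.val z ≠ ∞ := fun z hz => hK.val_ne_top_of_mem hφ hz
    have hz := hf _ z.2
    have hz' := hf _ z'.2
    have hnz := hf _ (neg_mem z.2)
    have hnz' := hf _ (neg_mem z'.2)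
    have h0 := fun x : A => CFC.posPart_nonneg x
    have h0' := fun x : A => CFC.negPart_nonneg x
    rw [val_toReal_sub_val_toReal (p := (z : A)⁺ + (z' : A)⁺) (q := (z : A)⁻ + (z' : A)⁻)
      (z + z').2.1 (hf _ (z + z').2) (hf _ (neg_mem (z + z').2)) (add_nonneg (h0 _) (h0 _))
      (add_nonneg (h0' _) (h0' _))]
    · rw [φ.val_add (h0 _) (h0 _), φ.val_add (h0' _) (h0' _), val_posPart, val_posPart, val_negPart,
        val_negPart, ENNReal.toReal_add hz hz', ENNReal.toReal_add hnz hnz']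
      ring
    · rw [φ.val_add (h0 _) (h0 _), val_posPart, val_posPart]
      exact ENNReal.add_ne_top.mpr ⟨hz, hz'⟩
    · rw [φ.val_add (h0' _) (h0' _), val_negPart, val_negPart]
      exact ENNReal.add_ne_top.mpr ⟨hnz, hnz'⟩
    · rw [add_sub_add_comm, CFC.posPart_sub_negPart _ z.2.1, CFC.posPart_sub_negPart _ z'.2.1]
      rfl
  map_smul' c z := by
    have key : ∀ c : ℝ, 0 ≤ c → ∀ x : A, φ.val (c • x) = ENNReal.ofReal c * φ.val x := by
      intro c hc x
      rw [← val_posPart, CFC.posPart_smul_of_nonneg hc, φ.val_smul hc (CFC.posPart_nonneg x),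
        val_posPart]
    simp only [RingHom.id_apply, Submodule.coe_smul, smul_eq_mul]
    rcases le_total 0 c with h | h
    · rw [← smul_neg, key c h, key c h, ENNReal.toReal_mul, ENNReal.toReal_mul,
        ENNReal.toReal_ofReal h]
      ring
    · have h' : 0 ≤ -c := neg_nonneg.mpr h
      have e1 : c • (z : A) = (-c) • (-(z : A)) := by simp
      have e2 : -(c • (z : A)) = (-c) • (z : A) := by simp
      rw [e2, e1, key _ h', key _ h',
        ENNReal.toReal_mul, ENNReal.toReal_mul, ENNReal.toReal_ofReal h']
      ring

theorem FiniteOnPedersenIdeal.linearExtension_eq_realExtension (hK : φ.FiniteOnPedersenIdeal)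
    (hφ : LowerSemicontinuous φ.toFun) {z : A} (hz : z ∈ pedersenIdeal A) :
    φ.linearExtension z =
      (realExtension hK hφ ⟨_, (mem_dominatedSubmodule_of_mem hz).1⟩ : ℂ) +
        (realExtension hK hφ ⟨_, (mem_dominatedSubmodule_of_mem hz).2⟩ : ℂ) * Complex.I :=
  φ.linearExtension_eq z

theorem FiniteOnPedersenIdeal.linearExtension_add (hK : φ.FiniteOnPedersenIdeal)
    (hφ : LowerSemicontinuous φ.toFun) {z z' : A} (hz : z ∈ pedersenIdeal A)
    (hz' : z' ∈ pedersenIdeal A) :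
    φ.linearExtension (z + z') = φ.linearExtension z + φ.linearExtension z' := by
  have h1 := mem_dominatedSubmodule_of_mem hz
  have h2 := mem_dominatedSubmodule_of_mem hz'
  have hr : (⟨_, (mem_dominatedSubmodule_of_mem (add_mem hz hz')).1⟩ : dominatedSubmodule A) =
      ⟨_, h1.1⟩ + ⟨_, h2.1⟩ := Subtype.ext (by simp)
  have hi : (⟨_, (mem_dominatedSubmodule_of_mem (add_mem hz hz')).2⟩ : dominatedSubmodule A) =
      ⟨_, h1.2⟩ + ⟨_, h2.2⟩ := Subtype.ext (by simp)
  rw [hK.linearExtension_eq_realExtension hφ hz, hK.linearExtension_eq_realExtension hφ hz',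
    hK.linearExtension_eq_realExtension hφ (add_mem hz hz'), hr, hi, _root_.map_add,
    _root_.map_add]
  push_cast
  ring

theorem FiniteOnPedersenIdeal.linearExtension_smul (hK : φ.FiniteOnPedersenIdeal)
    (hφ : LowerSemicontinuous φ.toFun) (c : ℂ) {z : A} (hz : z ∈ pedersenIdeal A) :
    φ.linearExtension (c • z) = c * φ.linearExtension z := by
  have h1 := mem_dominatedSubmodule_of_mem hz
  have hc := Submodule.smul_mem _ c hz
  have hr : (⟨_, (mem_dominatedSubmodule_of_mem hc).1⟩ : dominatedSubmodule A) =
      c.re • ⟨_, h1.1⟩ - c.im • ⟨_, h1.2⟩ := Subtype.ext (by simp [realPart_smul])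
  have hi : (⟨_, (mem_dominatedSubmodule_of_mem hc).2⟩ : dominatedSubmodule A) =
      c.re • ⟨_, h1.2⟩ + c.im • ⟨_, h1.1⟩ := Subtype.ext (by simp [imaginaryPart_smul])
  rw [hK.linearExtension_eq_realExtension hφ hz, hK.linearExtension_eq_realExtension hφ hc, hr, hi,
    map_sub, _root_.map_add, _root_.map_smul, _root_.map_smul, _root_.map_smul, _root_.map_smul]
  nth_rewrite 5 [← Complex.re_add_im c]
  push_cast [smul_eq_mul]
  linear_combination (-c.im * realExtension hK hφ ⟨_, h1.2⟩ : ℂ) * Complex.I_sq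

/-- The linear functional on the minimal dense ideal determined by a weight. -/
noncomputable def linearExtensionₗ (hK : φ.FiniteOnPedersenIdeal)
    (hφ : LowerSemicontinuous φ.toFun) : pedersenIdeal A →ₗ[ℂ] ℂ where
  toFun z := φ.linearExtension z
  map_add' z z' := hK.linearExtension_add hφ z.2 z'.2
  map_smul' c z := hK.linearExtension_smul hφ c z.2

end Weight

end CStarJensen

/-! ### Weights with y in the centralizer, and inequality (ii). -/

namespace CStarJensen

variable {A : Type*} [NonUnitalCStarAlgebra A] [PartialOrder A] [StarOrderedRing A]

namespace Weight

variable {φ : Weight A}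

theorem FiniteOnPedersenIdeal.linearExtension_sum (hK : φ.FiniteOnPedersenIdeal)
    (hφ : LowerSemicontinuous φ.toFun) {ι : Type*} (F : Finset ι) (g : ι → A)
    (hg : ∀ i ∈ F, g i ∈ pedersenIdeal A) :
    φ.linearExtension (∑ i ∈ F, g i) = ∑ i ∈ F, φ.linearExtension (g i) := by
  have := map_sum (linearExtensionₗ hK hφ) (fun i : F => ⟨g i, hg i i.2⟩) Finset.univ
  rw [← Finset.sum_coe_sort F, ← Finset.sum_coe_sort F fun i => φ.linearExtension (g i)]
  refine Eq.trans ?_ this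
  change _ = φ.linearExtension ((∑ i : F, (⟨g i, hg i i.2⟩ : pedersenIdeal A) : pedersenIdeal A) : A)
  rw [AddSubmonoidClass.coe_finsetSum]

/-- Polarization gives a quarter of four terms u* x u with ‖u‖ ≤ 2, each of weight at most 4M by
scaling u to the unit ball. -/
theorem FiniteOnPedersenIdeal.exists_norm_linearExtension_le (hK : φ.FiniteOnPedersenIdeal)
    (hφ : LowerSemicontinuous φ.toFun) {x : A} (hx : x ∈ pedersenCone A) :
    ∃ M : ℝ, ∀ v w : 𝓜(ℂ, A), ‖v‖ ≤ 1 → ‖w‖ ≤ 1 →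
      ‖φ.linearExtension (v.fst (w.snd x))‖ ≤ M := by
  obtain ⟨M, hM⟩ := hK.exists_val_sandwich_le hφ hx
  have hb : ∀ u : 𝓜(ℂ, A), ‖u‖ ≤ 2 → ‖φ.linearExtension (sandwich u x)‖ ≤ 4 * M := by
    intro u hu
    have h0 := sandwich_nonneg ((2⁻¹ : ℂ) • u) hx.1
    have h1 : sandwich u x = (4 : ℝ) • sandwich ((2⁻¹ : ℂ) • u) x := by
      rw [sandwich_smul, smul_smul]; norm_num
    have h2 : φ.val (sandwich ((2⁻¹ : ℂ) • u) x) ≤ M := by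
      refine hM _ ?_
      rw [norm_smul]; norm_num; linarith
    rw [φ.linearExtension_of_nonneg (sandwich_nonneg u hx.1), Complex.norm_real,
      Real.norm_of_nonneg ENNReal.toReal_nonneg, h1, φ.val_smul (by norm_num) h0,
      ENNReal.toReal_mul, ENNReal.toReal_ofReal (by norm_num)]
    gcongr
    exact ENNReal.toReal_le_coe_of_le_coe h2
  refine ⟨4 * M, fun v w hv hw => ?_⟩
  have hmem := fun u => pedersenCone_subset (sandwich_mem_pedersenCone u hx)
  have hI : ‖Complex.I • w‖ = ‖w‖ := by rw [norm_smul, Complex.norm_I, one_mul]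
  rw [← star_star v, polarization_sandwich]
  set v' := star v with hv'
  have hv1 : ‖v'‖ ≤ 1 := by rwa [norm_star]
  have hs := fun (c : ℂ) u => Submodule.smul_mem _ c (hmem u)
  rw [hK.linearExtension_smul hφ _ (add_mem (sub_mem (sub_mem (hmem _) (hmem _)) (hs _ _))
    (hs _ _)), hK.linearExtension_add hφ (sub_mem (sub_mem (hmem _) (hmem _)) (hs _ _)) (hs _ _),
    sub_eq_add_neg, sub_eq_add_neg, ← neg_one_smul ℂ (sandwich (v' - w) x),
    ← neg_one_smul ℂ (Complex.I • _),
    hK.linearExtension_add hφ (add_mem (hmem _) (hs _ _)) (Submodule.smul_mem _ _ (hs _ _)),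
    hK.linearExtension_add hφ (hmem _) (hs _ _), hK.linearExtension_smul hφ _ (hmem _),
    hK.linearExtension_smul hφ _ (hs _ _), hK.linearExtension_smul hφ _ (hmem _),
    hK.linearExtension_smul hφ _ (hmem _)]
  have e1 := hb (v' + w) ((norm_add_le _ _).trans (by linarith))
  have e2 := hb (v' - w) ((norm_sub_le _ _).trans (by linarith))
  have e3 := hb (v' + Complex.I • w) ((norm_add_le _ _).trans (by linarith))
  have e4 := hb (v' - Complex.I • w) ((norm_sub_le _ _).trans (by linarith))
  rw [norm_mul]
  have e5 : ‖(4 : ℂ)⁻¹‖ = 1 / 4 := by norm_num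
  rw [e5]
  refine (mul_le_mul_of_nonneg_left (norm_add_le_of_le (norm_add_le_of_le (norm_add_le _ _) le_rfl)
    le_rfl) (by norm_num)).trans ?_
  simp only [norm_mul, norm_neg, norm_one, Complex.norm_I, one_mul]
  linarith

/-- For x in the cone this is a linear functional bounded on the unit ball; continuity then passes
to the span. L stands for left or right multiplication. -/
theorem FiniteOnPedersenIdeal.continuous_linearExtension (hK : φ.FiniteOnPedersenIdeal)
    (hφ : LowerSemicontinuous φ.toFun) (L : 𝓜(ℂ, A) →ₗ[ℂ] A →ₗ[ℂ] A)
    (hL : ∀ u, ∀ x ∈ pedersenIdeal A, L u x ∈ pedersenIdeal A)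
    (hLb : ∀ x ∈ pedersenCone A, ∃ M : ℝ, ∀ u : 𝓜(ℂ, A), ‖u‖ ≤ 1 →
      ‖φ.linearExtension (L u x)‖ ≤ M) {x : A} (hx : x ∈ pedersenIdeal A) :
    Continuous fun u : 𝓜(ℂ, A) => φ.linearExtension (L u x) := by
  induction hx using Submodule.span_induction with
  | mem x hx =>
    obtain ⟨M, hM⟩ := hLb x hx
    have hmem := fun u => hL u x (pedersenCone_subset hx)
    let G : 𝓜(ℂ, A) →ₗ[ℂ] ℂ :=
      { toFun := fun u => φ.linearExtension (L u x)
        map_add' := fun u v => by simpa using hK.linearExtension_add hφ (hmem u) (hmem v)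
        map_smul' := fun c u => by simpa using hK.linearExtension_smul hφ c (hmem u) }
    exact (G.mkContinuous _ fun u => G.bound_of_ball_bound' one_pos M
      (fun u hu => hM u (by simpa using hu)) u).continuous
  | zero => simpa using continuous_const
  | add x y hx hy hx' hy' =>
    simp only [_root_.map_add, hK.linearExtension_add hφ (hL _ _ hx) (hL _ _ hy)]
    exact hx'.add hy'
  | smul c x hx hx' =>
    simp only [_root_.map_smul, hK.linearExtension_smul hφ c (hL _ _ hx)]
    exact hx'.const_mul c

theorem FiniteOnPedersenIdeal.continuous_linearExtension_fst (hK : φ.FiniteOnPedersenIdeal)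
    (hφ : LowerSemicontinuous φ.toFun) {x : A} (hx : x ∈ pedersenIdeal A) :
    Continuous fun u : 𝓜(ℂ, A) => φ.linearExtension (u.fst x) := by
  refine hK.continuous_linearExtension hφ (LinearMap.mk₂ ℂ (fun u x => u.fst x) (by simp) (by simp)
    (by simp) (by simp)) (fun u x hx => fst_mem_pedersenIdeal u hx) (fun x hx => ?_) hx
  obtain ⟨M, hM⟩ := hK.exists_norm_linearExtension_le hφ hx
  exact ⟨M, fun u hu => by simpa using hM u 1 hu (by nontriviality 𝓜(ℂ, A); simp)⟩

theorem FiniteOnPedersenIdeal.continuous_linearExtension_snd (hK : φ.FiniteOnPedersenIdeal)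
    (hφ : LowerSemicontinuous φ.toFun) {x : A} (hx : x ∈ pedersenIdeal A) :
    Continuous fun u : 𝓜(ℂ, A) => φ.linearExtension (u.snd x) := by
  refine hK.continuous_linearExtension hφ (LinearMap.mk₂ ℂ (fun u x => u.snd x) (by simp) (by simp)
    (by simp) (by simp)) (fun u x hx => snd_mem_pedersenIdeal u hx) (fun x hx => ?_) hx
  obtain ⟨M, hM⟩ := hK.exists_norm_linearExtension_le hφ hx
  exact ⟨M, fun u hu => by simpa using hM 1 u (by nontriviality 𝓜(ℂ, A); simp) hu⟩

/-- The multipliers that commute with K(A) under φ form an algebra, closed by the continuity just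
shown. -/
theorem InCentralizer.linearExtension_cfc_comm {y : A} (hy : φ.InCentralizer y)
    (hysa : IsSelfAdjoint y) (hK : φ.FiniteOnPedersenIdeal) (hφ : LowerSemicontinuous φ.toFun)
    {x : A} (hx : x ∈ pedersenIdeal A) (g : ℝ → ℝ) :
    φ.linearExtension ((cfc g (y : 𝓜(ℂ, A))).snd x) =
      φ.linearExtension ((cfc g (y : 𝓜(ℂ, A))).fst x) := by
  have hf := fun (u : 𝓜(ℂ, A)) {x : A} => fst_mem_pedersenIdeal u (x := x)
  have hs := fun (u : 𝓜(ℂ, A)) {x : A} => snd_mem_pedersenIdeal u (x := x)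
  let S : Subalgebra ℝ 𝓜(ℂ, A) :=
    { carrier := {u | ∀ x ∈ pedersenIdeal A,
        φ.linearExtension (u.snd x) = φ.linearExtension (u.fst x)}
      mul_mem' := fun {u v} hu hv x hx => by
        have h : v.fst (u.snd x) = u.snd (v.fst x) := by
          apply coe_injective
          simp only [coe_fst, coe_snd, mul_assoc]
        simpa using (hv _ (hs u hx)).trans ((congrArg _ h).trans (hu _ (hf v hx)))
      add_mem' := fun {u v} hu hv x hx => by
        simpa using (hK.linearExtension_add hφ (hs u hx) (hs v hx)).trans
          ((congrArg₂ _ (hu x hx) (hv x hx)).trans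
            (hK.linearExtension_add hφ (hf u hx) (hf v hx)).symm)
      algebraMap_mem' := fun r x hx => rfl }
  have hS : IsClosed (S : Set 𝓜(ℂ, A)) := by
    have : (S : Set 𝓜(ℂ, A)) = ⋂ (x : A) (_ : x ∈ pedersenIdeal A),
        {u : 𝓜(ℂ, A) | φ.linearExtension (u.snd x) = φ.linearExtension (u.fst x)} := by
      ext u
      simp only [Set.mem_iInter]
      rfl
    rw [this]
    exact isClosed_biInter fun x hx => isClosed_eq (hK.continuous_linearExtension_snd hφ hx)
      (hK.continuous_linearExtension_fst hφ hx)
  exact cfc_mem_of_isClosed S hS (coe_isSelfAdjoint_iff.mpr hysa) (fun x hx => hy x hx) g x hx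

/-- The values of a weight at `z` and at an average `∑ qᵢ z qᵢ` with `qᵢ` in the C*-algebra
generated by an element of the centralizer. -/
theorem InCentralizer.val_sum_sandwich_le {y : A} (hy : φ.InCentralizer y)
    (hysa : IsSelfAdjoint y) (hK : φ.FiniteOnPedersenIdeal) (hφ : LowerSemicontinuous φ.toFun)
    (F : Finset ℝ) (k : ℝ → ℝ → ℝ)
    (hk : ∑ i ∈ F, cfc (k i) (y : 𝓜(ℂ, A)) * cfc (k i) (y : 𝓜(ℂ, A)) = 1) {z : A} (hz : 0 ≤ z) :
    φ.val (∑ i ∈ F, sandwich (cfc (k i) (y : 𝓜(ℂ, A))) z) ≤ φ.val z := by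
  have hnn : ∀ z : A, 0 ≤ z → 0 ≤ ∑ i ∈ F, sandwich (cfc (k i) (y : 𝓜(ℂ, A))) z := fun z hz =>
    Finset.sum_nonneg fun i _ => sandwich_nonneg _ hz
  have hcone : ∀ z ∈ pedersenCone A,
      φ.val (∑ i ∈ F, sandwich (cfc (k i) (y : 𝓜(ℂ, A))) z) = φ.val z := by
    intro z hz
    have hzK := pedersenCone_subset hz
    have hmem : ∑ i ∈ F, sandwich (cfc (k i) (y : 𝓜(ℂ, A))) z ∈ pedersenCone A :=
      Finset.sum_induction _ (· ∈ pedersenCone A) (fun _ _ => add_mem_pedersenCone)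
        zero_mem_pedersenCone fun i _ => sandwich_mem_pedersenCone _ hz
    have hsum : ∑ i ∈ F, (cfc (k i) (y : 𝓜(ℂ, A))).snd ((cfc (k i) (y : 𝓜(ℂ, A))).snd z) = z := by
      apply coe_injective
      dsimp only
      simp only [coe_sum, coe_snd, mul_assoc]
      rw [← Finset.mul_sum, hk, mul_one]
    -- φ(q z q) = φ(z q q), since z q lies in the ideal and q can be moved across it.
    have key : φ.linearExtension (∑ i ∈ F, sandwich (cfc (k i) (y : 𝓜(ℂ, A))) z) =
        φ.linearExtension z := by
      nth_rewrite 2 [← hsum]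
      rw [hK.linearExtension_sum hφ F _
          fun i _ => pedersenCone_subset (sandwich_mem_pedersenCone _ hz),
        hK.linearExtension_sum hφ F _
          fun i _ => snd_mem_pedersenIdeal _ (snd_mem_pedersenIdeal _ hzK)]
      refine Finset.sum_congr rfl fun i _ => ?_
      rw [hy.linearExtension_cfc_comm hysa hK hφ (snd_mem_pedersenIdeal _ hzK), sandwich,
        (cfc_predicate (k i) (y : 𝓜(ℂ, A)) : IsSelfAdjoint _).star_eq]
    rw [φ.linearExtension_of_nonneg hmem.1, φ.linearExtension_of_nonneg hz.1,
      Complex.ofReal_inj] at key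
    exact (ENNReal.toReal_eq_toReal_iff' (hK.val_lt_top hmem).ne (hK.val_lt_top hz).ne).mp key
  -- A general z is approached from below by the cone; lower semicontinuity keeps only an
  -- inequality.
  choose u hu huz hun using fun n : ℕ =>
    exists_mem_pedersenCone_near hz (η := 1 / ((n : ℝ) + 1)) (by positivity)
  have hut : Tendsto u atTop (𝓝 z) := by
    rw [tendsto_iff_norm_sub_tendsto_zero]
    exact squeeze_zero (fun _ => norm_nonneg _) hun tendsto_one_div_add_atTop_nhds_zero_nat
  refine val_le_of_tendsto hφ (l := atTop)
    (u := fun n => ∑ i ∈ F, sandwich (cfc (k i) (y : 𝓜(ℂ, A))) (u n)) (fun n => hnn _ (hu n).1)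
    (tendsto_finsetSum _ fun i _ => ?_) fun n => ?_
  · exact ((continuous_sandwich.comp (Continuous.prodMk_right _)).tendsto z).comp hut
  · rw [hcone _ (hu n)]
    exact φ.val_mono (hu n).1 (huz n)

theorem val_le_extend {x : A} (hx : 0 ≤ x) {m : 𝓜(ℂ, A)} (h : (x : 𝓜(ℂ, A)) ≤ m) :
    φ.val x ≤ φ.extend m := by
  rw [φ.val_of_nonneg hx, extend]
  exact le_iSup₂_of_le ⟨x, hx⟩ h le_rfl

end Weight

/-- If `0 ≤ b ≤ c` with `c` invertible, then `b c⁻¹ b ≤ b`. -/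
theorem mul_inv_mul_le {B : Type*} [CStarAlgebra B] [PartialOrder B] [StarOrderedRing B] {b : B}
    (hb : 0 ≤ b) {c : Bˣ} (hbc : b ≤ c) : b * (↑c⁻¹ : B) * b ≤ b := by
  have hc : (0 : B) ≤ c := hb.trans hbc
  have hc' : (0 : B) ≤ ↑c⁻¹ := CFC.inv_nonneg_of_nonneg c hc
  have h := (le_iff_norm_sqrt_mul_sqrt_inv hb hc).mp hbc
  set s := CFC.sqrt b with hs
  set t := CFC.sqrt (↑c⁻¹ : B) with ht
  have hss : s * s = b := CFC.sqrt_mul_sqrt_self b hb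
  have htt : t * t = (↑c⁻¹ : B) := CFC.sqrt_mul_sqrt_self _ hc'
  have hssa : IsSelfAdjoint s := (CFC.sqrt_nonneg b).isSelfAdjoint
  have htsa : IsSelfAdjoint t := (CFC.sqrt_nonneg (↑c⁻¹ : B)).isSelfAdjoint
  have h1 : (s * t) * star (s * t) ≤ 1 := by
    refine CStarAlgebra.mul_star_le_algebraMap_norm_sq.trans ?_
    rw [← map_one (algebraMap ℝ B)]
    exact algebraMap_mono B (pow_le_one₀ (norm_nonneg _) h)
  have h2 := hssa.conjugate_le_conjugate h1
  rw [star_mul, hssa.star_eq, htsa.star_eq, mul_one, hss] at h2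
  refine le_trans (le_of_eq ?_) h2
  rw [← hss, ← htt]
  noncomm_ring

/-- If `x ≤ B + η`, then `√x` is up to `√η` of the form `B v` with `b v v* b ≤ b` whenever
`0 ≤ b ≤ B`. -/
theorem exists_sqrt_eq_add {x : A} (hx : 0 ≤ x) {B : 𝓜(ℂ, A)} (hB : 0 ≤ B) {η : ℝ} (hη : 0 < η)
    (hxB : (x : 𝓜(ℂ, A)) ≤ B + η • 1) :
    ∃ v : A, ‖B.fst v - CFC.sqrt x‖ ≤ √η ∧
      ∀ b : A, 0 ≤ b → (b : 𝓜(ℂ, A)) ≤ B → b * v * star (b * v) ≤ b := by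
  have hsp : IsStrictlyPositive (B + η • (1 : 𝓜(ℂ, A))) := by
    have h1 : IsStrictlyPositive (η • (1 : 𝓜(ℂ, A))) := by
      rw [← Algebra.algebraMap_eq_smul_one]
      exact IsStrictlyPositive.iff_of_unital.mpr ⟨algebraMap_nonneg _ hη.le,
        (isUnit_iff_ne_zero.mpr hη.ne').map (algebraMap ℝ 𝓜(ℂ, A))⟩
    exact h1.of_le (le_add_of_nonneg_left hB)
  obtain ⟨c, hc⟩ := hsp.isUnit
  have hc0 : (0 : 𝓜(ℂ, A)) ≤ c := hc ▸ hsp.nonneg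
  have hk0 : (0 : 𝓜(ℂ, A)) ≤ ↑c⁻¹ := CFC.inv_nonneg_of_nonneg c hc0
  set k : 𝓜(ℂ, A) := ↑c⁻¹ with hk
  have hksa : star k = k := hk0.isSelfAdjoint
  set r : A := CFC.sqrt x with hr
  have hrr : (r : 𝓜(ℂ, A)) * r = x := by rw [← coe_mul, hr, CFC.sqrt_mul_sqrt_self x hx]
  have hrsa : star (r : 𝓜(ℂ, A)) = r := by
    rw [← coe_star, (CFC.sqrt_nonneg x).isSelfAdjoint.star_eq]
  have hkxk : k * x * k ≤ k := by
    have := IsSelfAdjoint.conjugate_le_conjugate (hxB.trans_eq hc.symm) hksa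
    rwa [hk, Units.inv_mul, one_mul, ← hk] at this
  have hkn : ‖k‖ ≤ η⁻¹ := by
    rw [CStarAlgebra.norm_le_iff_le_algebraMap k (by positivity)]
    let d : (𝓜(ℂ, A))ˣ := Units.map (algebraMap ℝ 𝓜(ℂ, A) : ℝ →* 𝓜(ℂ, A)) (Units.mk0 η hη.ne')
    have hd : (d : 𝓜(ℂ, A)) = η • 1 := Algebra.algebraMap_eq_smul_one η
    refine CStarAlgebra.inv_le_inv (a := d) (b := c) ?_ ?_
    · rw [hd]; exact smul_nonneg hη.le zero_le_one
    · rw [hd, hc]; exact le_add_of_nonneg_left hB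
  -- With k = (B + η)⁻¹ and v = k√x, B v = √x - η k √x, and ‖k√x‖² = ‖k x k‖ ≤ ‖k‖ ≤ 1/η bounds the
  -- error by √η. Also v v* = k x k ≤ k.
  refine ⟨k.fst r, ?_, fun b hb hbB => ?_⟩
  · have h1 : ((B.fst (k.fst r) - r : A) : 𝓜(ℂ, A)) = -(η • (k * r)) := by
      have h2 : ((c : 𝓜(ℂ, A)) * k) * r = r := by rw [hk, Units.mul_inv, one_mul]
      rw [hc, add_mul, add_mul, smul_mul_assoc, one_mul, smul_mul_assoc] at h2
      rw [coe_sub, coe_fst, coe_fst, ← mul_assoc]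
      nth_rewrite 2 [← h2]
      abel
    rw [← norm_coe, h1, norm_neg, norm_smul, Real.norm_of_nonneg hη.le]
    refine Real.le_sqrt_of_sq_le ?_
    have h3 : ‖k * (r : 𝓜(ℂ, A))‖ ^ 2 ≤ η⁻¹ := by
      rw [sq, ← CStarRing.norm_self_mul_star, star_mul, hrsa, hksa, ← mul_assoc, mul_assoc k, hrr]
      refine (CStarAlgebra.norm_le_norm_of_nonneg_of_le ?_ hkxk).trans hkn
      exact hk0.isSelfAdjoint.conjugate_nonneg (coe_nonneg hx)
    rw [mul_pow]
    calc η ^ 2 * _ ≤ η ^ 2 * η⁻¹ := by gcongr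
      _ = η := by field_simp
  · rw [← coe_le_coe_iff]
    have hbsa : star (b : 𝓜(ℂ, A)) = b := (coe_nonneg hb).isSelfAdjoint
    refine le_trans ?_ (mul_inv_mul_le (coe_nonneg hb) (c := c) (by
      rw [hc]; exact hbB.trans (le_add_of_nonneg_right (smul_nonneg hη.le zero_le_one))))
    refine le_trans (le_of_eq ?_) (IsSelfAdjoint.conjugate_le_conjugate hkxk hbsa)
    rw [coe_mul, coe_star, coe_mul, coe_fst, star_mul, star_mul, hrsa, hksa, hbsa, ← hrr]
    noncomm_ring

namespace Weight

variable {φ : Weight A}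

/-- Jensen's inequality for a lower semicontinuous weight with `y` in its centralizer. -/
theorem InCentralizer.extend_cfc_le {y : A} (hy : φ.InCentralizer y) (hysa : IsSelfAdjoint y)
    (hK : φ.FiniteOnPedersenIdeal) (hφ : LowerSemicontinuous φ.toFun)
    {I : Set ℝ} {f : ℝ → ℝ} (hf : ContinuousOn f I) (hfc : ConvexOn ℝ I f) {w : 𝓜(ℂ, A)}
    (hw0 : 0 ≤ w) (hyI : spectrum ℝ (y : 𝓜(ℂ, A)) ⊆ I)
    (hw : ∀ c d : ℝ, (∀ t ∈ I, c * t + d ≤ f t) →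
      c • (y : 𝓜(ℂ, A)) + d • (1 : 𝓜(ℂ, A)) ≤ w) :
    φ.extend (cfc f (y : 𝓜(ℂ, A))) ≤ φ.extend w := by
  have hysa' : IsSelfAdjoint (y : 𝓜(ℂ, A)) := coe_isSelfAdjoint_iff.mpr hysa
  refine iSup₂_le fun ⟨x, hx⟩ hxf => ?_
  rw [← φ.val_of_nonneg hx]
  change (x : 𝓜(ℂ, A)) ≤ _ at hxf
  set r : 𝓜(ℂ, A) := CFC.sqrt w with hr
  have hrr : r * r = w := CFC.sqrt_mul_sqrt_self w hw0
  have hrsa : star r = r := (CFC.sqrt_nonneg w).isSelfAdjoint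
  have hl := CStarAlgebra.increasingApproximateUnit A
  have key : ∀ η : ℝ, 0 < η → ∃ z : A, ‖z - CFC.sqrt x‖ ≤ √η ∧
      φ.val (z * star z) ≤ φ.extend w := by
    intro η hη
    obtain ⟨F, k, -, hk1, hle⟩ := exists_cfc_le_sum hf hfc hysa' hyI hw hη
    set q : ℝ → 𝓜(ℂ, A) := fun i => cfc (k i) (y : 𝓜(ℂ, A)) with hq
    have hqsa : ∀ i, star (q i) = q i := fun i => (cfc_predicate (k i) (y : 𝓜(ℂ, A)))
    set B : 𝓜(ℂ, A) := ∑ i ∈ F, q i * w * q i with hB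
    have hB0 : 0 ≤ B := Finset.sum_nonneg fun i _ => IsSelfAdjoint.conjugate_nonneg hw0 (hqsa i)
    obtain ⟨v, hv, hvb⟩ := exists_sqrt_eq_add hx hB0 hη (hxf.trans hle)
    refine ⟨B.fst v, hv, ?_⟩
    -- These elements of A₊ lie below B. They need not tend to B in norm, but b(e) v tends to B v
    -- because v is in A.
    let b : A → A := fun e => ∑ i ∈ F, sandwich (q i) (sandwich r e)
    have hbcoe : ∀ e : A, (b e : 𝓜(ℂ, A)) = ∑ i ∈ F, q i * (r * e * r) * q i := fun e => by
      rw [coe_sum]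
      exact Finset.sum_congr rfl fun i _ => by rw [coe_sandwich, coe_sandwich, hqsa, hrsa]
    have hbt : Tendsto (fun e => b e * v) (CStarAlgebra.approximateUnit A) (𝓝 (B.fst v)) := by
      have h1 : ∀ e, b e * v = ∑ i ∈ F, (q i * r).fst (e * (r * q i).fst v) := fun e => by
        refine coe_injective ?_
        dsimp only
        rw [coe_mul, hbcoe, coe_sum, Finset.sum_mul]
        refine Finset.sum_congr rfl fun i _ => ?_
        rw [coe_fst, coe_mul, coe_fst]
        noncomm_ring
      have h2 : B.fst v = ∑ i ∈ F, (q i * r).fst ((r * q i).fst v) := by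
        refine coe_injective ?_
        dsimp only
        rw [coe_fst, coe_sum, hB, Finset.sum_mul]
        refine Finset.sum_congr rfl fun i _ => ?_
        rw [coe_fst, coe_fst, ← hrr]
        noncomm_ring
      simp only [h1, h2]
      exact tendsto_finsetSum _ fun i _ =>
        ((q i * r).fst.continuous.tendsto _).comp (hl.tendsto_mul_right _)
    have hne := hl.neBot
    have hev : ∀ᶠ e in CStarAlgebra.approximateUnit A, φ.val (b e * v * star (b e * v)) ≤
        φ.extend w := by
      filter_upwards [hl.eventually_nonneg, hl.eventually_norm] with e he0 he1
      have hre0 : 0 ≤ sandwich r e := sandwich_nonneg r he0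
      have hre : r * (e : 𝓜(ℂ, A)) * r ≤ w := by
        have h1 : (e : 𝓜(ℂ, A)) ≤ 1 := by
          rw [← CStarAlgebra.norm_le_one_iff_of_nonneg _ (coe_nonneg he0), norm_coe]
          exact he1
        simpa [hrr] using IsSelfAdjoint.conjugate_le_conjugate h1 hrsa
      have hb0 : 0 ≤ b e := Finset.sum_nonneg fun i _ => sandwich_nonneg _ hre0
      have hbB : (b e : 𝓜(ℂ, A)) ≤ B := by
        rw [hbcoe]
        exact Finset.sum_le_sum fun i _ => IsSelfAdjoint.conjugate_le_conjugate hre (hqsa i)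
      calc _ ≤ φ.val (b e) := φ.val_mono (mul_star_self_nonneg _) (hvb _ hb0 hbB)
        _ ≤ φ.val (sandwich r e) := hy.val_sum_sandwich_le hysa hK hφ F k hk1 hre0
        _ ≤ φ.extend w := val_le_extend hre0 (by rwa [coe_sandwich, hrsa])
    have hlim : Tendsto (fun e => b e * v * star (b e * v)) (CStarAlgebra.approximateUnit A)
        (𝓝 (B.fst v * star (B.fst v))) := hbt.mul hbt.star
    exact val_le_of_eventually hφ (fun _ => mul_star_self_nonneg _) hlim hev
  -- The square makes √η equal to 1/(n+1).
  choose z hz hzφ using fun n : ℕ => key ((1 / ((n : ℝ) + 1)) ^ 2) (by positivity)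
  have hzt : Tendsto z atTop (𝓝 (CFC.sqrt x)) := by
    rw [tendsto_iff_norm_sub_tendsto_zero]
    refine squeeze_zero (fun _ => norm_nonneg _) (fun n => ?_)
      tendsto_one_div_add_atTop_nhds_zero_nat
    exact (hz n).trans_eq (Real.sqrt_sq (by positivity))
  have hlim := hzt.mul hzt.star
  rw [(CFC.sqrt_nonneg x).isSelfAdjoint.star_eq, CFC.sqrt_mul_sqrt_self x hx] at hlim
  exact val_le_of_tendsto hφ (fun _ => mul_star_self_nonneg _) hlim hzφ

end Weight

end CStarJensen

/-! ### Assembly of the results. -/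

theorem theorem4p1 {T : Type*} [TopologicalSpace T] [T2Space T] [LocallyCompactSpace T]
    [MeasurableSpace T] [BorelSpace T] (μ : Measure T) [μ.Regular]
    {A : Type*} [NonUnitalCStarAlgebra A] [PartialOrder A] [StarOrderedRing A]
    (I : Set ℝ) (f : ℝ → ℝ) (hf : ContinuousOn f I) (hfc : ConvexOn ℝ I f)
    (x : T → A) (hx : Continuous x) (hxb : ∃ C : ℝ, ∀ t, ‖x t‖ ≤ C)
    (hxsa : ∀ t, IsSelfAdjoint (x t)) (hxI : ∀ t, spectrum ℝ (x t : 𝓜(ℂ, A)) ⊆ I)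
    (a : T → 𝓜(ℂ, A)) (ha : CStarJensen.IsUnitalColumnField μ a) :
    -- the integral `y` exists, and `f(y)` is defined
    Integrable (fun t => CStarJensen.sandwich (a t) (x t)) μ ∧
    IsSelfAdjoint (CStarJensen.columnMean μ a x) ∧
    spectrum ℝ ((CStarJensen.columnMean μ a x : A) : 𝓜(ℂ, A)) ⊆ I ∧
    -- the integral on the right-hand side exists if `I` is closed or `(f(x_t))` is bounded
    (IsClosed I ∨ (∃ C : ℝ, ∀ t, ‖cfc f (x t : 𝓜(ℂ, A))‖ ≤ C) →
      Integrable (fun t => star (a t) * cfc f (x t : 𝓜(ℂ, A)) * a t) μ) ∧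
    -- Jensen's inequality whenever that integral exists
    (Integrable (fun t => star (a t) * cfc f (x t : 𝓜(ℂ, A)) * a t) μ →
      (∀ φ : A →ₚ[ℂ] ℂ, CStarJensen.InCentralizer φ (CStarJensen.columnMean μ a x) →
        CStarJensen.extend φ (cfc f ((CStarJensen.columnMean μ a x : A) : 𝓜(ℂ, A))) ≤
          CStarJensen.extend φ (∫ t, star (a t) * cfc f (x t : 𝓜(ℂ, A)) * a t ∂μ)) ∧
      (∀ φ : CStarJensen.Weight A, LowerSemicontinuous φ.toFun → φ.FiniteOnPedersenIdeal →
        φ.InCentralizer (CStarJensen.columnMean μ a x) → (∀ s ∈ I, 0 ≤ f s) →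
        φ.extend (cfc f ((CStarJensen.columnMean μ a x : A) : 𝓜(ℂ, A))) ≤
          φ.extend (∫ t, star (a t) * cfc f (x t : 𝓜(ℂ, A)) * a t ∂μ))) := by
  -- That I is an interval is contained in `hfc`: its domain is convex.
  have hI := hfc.1.ordConnected
  obtain ⟨C, hC⟩ := hxb
  have hyI := ha.spectrum_columnMean_subset hI hx hC hxsa hxI
  have hysa := CStarJensen.isSelfAdjoint_columnMean (μ := μ) (a := a) hxsa
  refine ⟨ha.integrable_sandwich hx hC, hysa, hyI,
    ha.integrable_cfc hI hf hx ⟨C, hC⟩ hxsa hxI, fun hint => ?_⟩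
  have hw := fun (c d : ℝ) (h : ∀ t ∈ I, c * t + d ≤ f t) =>
    ha.affine_le_integral_cfc hf hx ⟨C, hC⟩ hxsa hxI hint h
  refine ⟨fun φ hφ => hφ.extend_cfc_le hysa hf hfc hyI hw, fun φ hφ hK hφy hf0 => ?_⟩
  refine hφy.extend_cfc_le hysa hK hφ hf hfc (integral_nonneg fun t => ?_) hyI hw
  exact star_left_conjugate_nonneg (cfc_nonneg fun s hs => hf0 s (hxI t hs)) _
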